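/- Let $K_0$ be a non-archimedean local field whose residue field has characteristic different from $2$, and let $\pi \in K_0$ be a uniformizer. Let $\ell$ be an odd prime different from the residue characteristic of $K_0$, and let $\rho$ be a primitive $\ell$-th root of unity in an algebraic closure $\Omega$ of $K_0$. A field extension $L/K_0$ is called dihedral if it is Galois and its Galois group is isomorphic to a dihedral group of order $2m \ge 4$. There is a largest integer $d$ such that $K_0(\rho)$ contains a primitive $\ell^d$-th root of unity. For every integer $n \ge 1$, there exists a dihedral extension of $K_0$ of degree $2\ell^n$ if and only if $[K_0(\rho):K_0]=2$ and $n \le d$. In this case, for every root $\sqrt[\ell^n]{\pi} \in \Omega$ of $X^{\ell^n}-\pi$, the field $K_0(\rho, \sqrt[\ell^n]{\pi})$ is a dihedral extension of $K_0$ of degree $2\ell^n$, and every dihedral extension of $K_0$ of degree $2\ell^n$ is isomorphic to it over $K_0$. -/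

import Mathlib

universe u v w

open scoped ValuativeRel IntermediateField

/-- A field extension `E / F` is dihedral if it is Galois and its Galois group is isomorphic to
a dihedral group of order `2 * m ≥ 4`. For `m = 2` this is the Klein four-group. -/
def IsDihedralExtension (F E : Type*) [Field F] [Field E] [Algebra F E] : Prop :=
  IsGalois F E ∧ ∃ m : ℕ, 2 ≤ m ∧ Nonempty ((E ≃ₐ[F] E) ≃* DihedralGroup m)

/-! Put `N = ℓ ^ n` and call `x` a one-unit if `‖x - 1‖ < 1`. The tame arguments rest on one fact:
if `‖N‖ = 1`, the `N`-th power map is an isometry of the one-units, hence onto by compactness. This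
plays the role of Hensel's lemma and lifts `N`-th roots of unity from residues.

Let L be dihedral of degree 2N over K, with rotation r and reflection s. Automorphisms act on
residues of units by power maps, so they commute there. As N is odd, r is a commutator and so acts
trivially on residues. For a suitable x the ratio r x / x then has exact order N modulo one-units,
and it lifts to a primitive N-th root of unity Z fixed by r and inverted by s
(`exists_isPrimitiveRoot_of_isometry`). Hence K(Z) is quadratic and equals K(ρ), which forces n ≤ d.

A Lagrange resolvent b satisfies r b = Z b. The product b · s b is multiplied by Z² under r, and its
N-th power lies in K. Since s inverts Z, the only N-th root of unity in K is 1, so every unit of K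
is an N-th power. Up to an N-th power of K, (b · s b)^N is therefore π^j; here j is prime to ℓ, and
Bézout yields an N-th root of π in L (`exists_pow_eq_uniformizer`). Comparing degrees identifies L
with K(ρ, α).

Conversely, X^N - π is irreducible and the degrees 2 and N are coprime, so K(ρ, α) has degree 2N;
its automorphisms are read off from their action on a root of unity and on α
(`isDihedralExtension_adjoin`). -/

theorem IsCompact.surjOn_of_isometryOn {X : Type*} [MetricSpace X] {S : Set X}
    (hS : IsCompact S) {f : X → X} (hf : Set.MapsTo f S S)
    (hd : ∀ x ∈ S, ∀ y ∈ S, dist (f x) (f y) = dist x y) : Set.SurjOn f S S := by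
  intro y hy
  have hcont : ContinuousOn f S := by
    refine LipschitzOnWith.continuousOn (K := 1) (LipschitzOnWith.of_dist_le_mul ?_)
    intro x hx y hy
    simp [hd x hx y hy]
  have hcl : IsClosed (f '' S) := (hS.image_of_continuousOn hcont).isClosed
  by_contra hny
  obtain ⟨ε, hε, hball⟩ := Metric.isOpen_iff.1 hcl.isOpen_compl y hny
  have hmem : ∀ k, f^[k] y ∈ S := fun k => (hf.iterate k) hy
  -- A point at distance `ε` from the image has an `ε`-separated orbit, which can have no convergent
  -- subsequence.
  have hstep : ∀ i k, ε ≤ dist (f^[i] y) (f^[i + (k + 1)] y) := by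
    intro i k
    induction i with
    | zero =>
      by_contra hlt
      push Not at hlt
      have : f^[k + 1] y ∈ Metric.ball y ε := by
        rw [Metric.mem_ball, dist_comm]
        simpa using hlt
      refine hball this ?_
      rw [Function.iterate_succ_apply']
      exact ⟨_, hmem k, rfl⟩
    | succ i ih =>
      rw [show i + 1 + (k + 1) = (i + (k + 1)) + 1 by ring, Function.iterate_succ_apply',
        Function.iterate_succ_apply', hd _ (hmem _) _ (hmem _)]
      exact ih
  obtain ⟨a, -, φ, hφ, hlim⟩ := hS.tendsto_subseq hmem
  have hc := hlim.cauchySeq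
  obtain ⟨N, hN⟩ := Metric.cauchySeq_iff.1 hc ε hε
  have h1 := hN N le_rfl (N + 1) (Nat.le_succ N)
  obtain ⟨k, hk⟩ := Nat.exists_eq_add_of_lt (hφ (Nat.lt_succ_self N))
  rw [Nat.succ_eq_add_one] at hk
  have h2 := hstep (φ N) k
  simp only [Function.comp] at h1
  rw [show φ N + (k + 1) = φ (N + 1) by omega] at h2
  linarith

/-! ### One-units and `N`-th powers in an ultrametric field. -/

section Ultrametric

variable {L : Type*} [NormedField L]

theorem norm_sub_eq_norm_div_sub_one {x y : L} (hy : ‖y‖ = 1) : ‖x - y‖ = ‖x / y - 1‖ := by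
  have h0 : y ≠ 0 := by rintro rfl; simp at hy
  rw [div_sub_one h0, norm_div, hy, div_one]

variable [IsUltrametricDist L]

theorem norm_eq_one_of_norm_sub_one_lt_one {x : L} (hx : ‖x - 1‖ < 1) : ‖x‖ = 1 := by
  have := IsUltrametricDist.norm_add_eq_max_of_norm_ne_norm (x := x - 1) (y := 1)
    (by rw [norm_one]; exact hx.ne)
  rw [sub_add_cancel, norm_one, max_eq_right hx.le] at this
  exact this

theorem norm_mul_sub_one_lt_one {x y : L} (hx : ‖x - 1‖ < 1) (hy : ‖y - 1‖ < 1) :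
    ‖x * y - 1‖ < 1 := by
  have : x * y - 1 = x * (y - 1) + (x - 1) := by ring
  rw [this]
  refine (IsUltrametricDist.norm_add_le_max _ _).trans_lt (max_lt ?_ hx)
  rwa [norm_mul, norm_eq_one_of_norm_sub_one_lt_one hx, one_mul]

theorem norm_inv_sub_one_lt_one {x : L} (hx : ‖x - 1‖ < 1) : ‖x⁻¹ - 1‖ < 1 := by
  have h1 := norm_eq_one_of_norm_sub_one_lt_one hx
  have h0 : x ≠ 0 := by rintro rfl; simp at h1
  have : x⁻¹ - 1 = -(x⁻¹ * (x - 1)) := by field_simp; ring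
  rw [this, norm_neg, norm_mul, norm_inv, h1]
  simpa using hx

theorem norm_pow_sub_one_lt_one {x : L} (hx : ‖x - 1‖ < 1) (i : ℕ) : ‖x ^ i - 1‖ < 1 := by
  induction i with
  | zero => simp
  | succ i ih => rw [pow_succ]; exact norm_mul_sub_one_lt_one ih hx

theorem norm_sum_lt_of_forall_lt {ι : Type*} {s : Finset ι} {f : ι → L} {C : ℝ} (hC : 0 < C)
    (h : ∀ i ∈ s, ‖f i‖ < C) : ‖∑ i ∈ s, f i‖ < C := by
  classical
  induction s using Finset.induction_on with
  | empty => simpa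
  | insert a s ha ih =>
    rw [Finset.sum_insert ha]
    exact (IsUltrametricDist.norm_add_le_max _ _).trans_lt
      (max_lt (h a (Finset.mem_insert_self _ _))
        (ih fun i hi => h i (Finset.mem_insert_of_mem hi)))

theorem norm_sum_eq_one_of_norm_sub_one_lt_one {N : ℕ} (hN : ‖(N : L)‖ = 1) {f : ℕ → L}
    (h : ∀ i, ‖f i - 1‖ < 1) : ‖∑ i ∈ Finset.range N, f i‖ = 1 := by
  have h1 : ‖∑ i ∈ Finset.range N, (f i - 1)‖ < 1 :=
    norm_sum_lt_of_forall_lt one_pos fun i _ => h i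
  have h2 : ∑ i ∈ Finset.range N, f i = ∑ i ∈ Finset.range N, (f i - 1) + N := by
    simp [Finset.sum_sub_distrib]
  rw [h2, IsUltrametricDist.norm_add_eq_max_of_norm_ne_norm (by rw [hN]; exact h1.ne), hN,
    max_eq_right h1.le]

/-- Factor out `x - 1`: the cofactor is a geometric sum of `N` one-units, hence as close to `N` as
needed to have norm 1. -/
theorem norm_pow_sub_one_eq {N : ℕ} (hN : ‖(N : L)‖ = 1) {x : L} (hx : ‖x - 1‖ < 1) :
    ‖x ^ N - 1‖ = ‖x - 1‖ := by
  rw [← mul_geom_sum, norm_mul,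
    norm_sum_eq_one_of_norm_sub_one_lt_one hN (norm_pow_sub_one_lt_one hx), mul_one]

theorem eq_one_of_pow_eq_one_of_norm_sub_one_lt_one {N : ℕ} (hN : ‖(N : L)‖ = 1) {x : L}
    (hx : ‖x - 1‖ < 1) (h : x ^ N = 1) : x = 1 := by
  have := norm_pow_sub_one_eq hN hx
  rw [h, sub_self, norm_zero] at this
  exact sub_eq_zero.1 (norm_eq_zero.1 this.symm)

theorem norm_pow_sub_pow_eq {N : ℕ} (hN : ‖(N : L)‖ = 1) {x y : L} (hy : ‖y‖ = 1)
    (h : ‖x - y‖ < 1) : ‖x ^ N - y ^ N‖ = ‖x - y‖ := by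
  rw [norm_sub_eq_norm_div_sub_one hy] at h ⊢
  rw [norm_sub_eq_norm_div_sub_one (by simp [hy]), ← div_pow, norm_pow_sub_one_eq hN h]

variable [ProperSpace L]

/-- The open unit ball around 1 is also closed, hence compact, and the power map is an isometry of
it. -/
theorem exists_pow_eq_of_norm_sub_one_lt_one {N : ℕ} (hN : ‖(N : L)‖ = 1) {x : L}
    (hx : ‖x - 1‖ < 1) : ∃ y : L, ‖y - 1‖ < 1 ∧ y ^ N = x := by
  have hcomp : IsCompact (Metric.ball (1 : L) 1) :=
    Metric.isCompact_of_isClosed_isBounded (IsUltrametricDist.isClosed_ball _ _)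
      Metric.isBounded_ball
  have hmem : ∀ y : L, y ∈ Metric.ball (1 : L) 1 ↔ ‖y - 1‖ < 1 := fun y => by
    rw [Metric.mem_ball, dist_eq_norm]
  obtain ⟨y, hy, hyx⟩ := hcomp.surjOn_of_isometryOn (f := fun y : L => y ^ N)
    (fun y hy => (hmem _).2 (norm_pow_sub_one_lt_one ((hmem y).1 hy) N))
    (fun a ha b hb => by
      rw [hmem] at ha hb
      rw [dist_eq_norm, dist_eq_norm,
        norm_pow_sub_pow_eq hN (norm_eq_one_of_norm_sub_one_lt_one hb)]
      have : a - b = (a - 1) + (1 - b) := by ring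
      rw [this]
      rw [norm_sub_rev] at hb
      exact (IsUltrametricDist.norm_add_le_max _ _).trans_lt (max_lt ha hb)) ((hmem x).2 hx)
  exact ⟨y, (hmem y).1 hy, hyx⟩

theorem exists_pow_eq_one_of_norm_pow_sub_one_lt_one {N : ℕ} (hN : ‖(N : L)‖ = 1) {u : L}
    (hu : ‖u‖ = 1) (h : ‖u ^ N - 1‖ < 1) : ∃ z : L, z ^ N = 1 ∧ ‖z / u - 1‖ < 1 := by
  have h0 : u ≠ 0 := by rintro rfl; simp at hu
  obtain ⟨y, hy, hyu⟩ := exists_pow_eq_of_norm_sub_one_lt_one hN h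
  refine ⟨u / y, ?_, ?_⟩
  · rw [div_pow, hyu, div_self (pow_ne_zero _ h0)]
  · rw [div_div_cancel_left' h0]
    exact norm_inv_sub_one_lt_one hy

/-- Without nontrivial roots of unity the power map is an isometry of the whole unit sphere: if `a ^
N` and `b ^ N` are close, `a / b` is close to an `N`-th root of unity, that is, to 1. -/
theorem exists_pow_eq_of_norm_eq_one {N : ℕ} (hN : ‖(N : L)‖ = 1)
    (hroot : ∀ z : L, z ^ N = 1 → z = 1) {u : L} (hu : ‖u‖ = 1) : ∃ v : L, v ^ N = u := by
  have hmem : ∀ y : L, y ∈ Metric.sphere (0 : L) 1 ↔ ‖y‖ = 1 := fun y => by simp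
  obtain ⟨v, -, hv⟩ := (isCompact_sphere (0 : L) 1).surjOn_of_isometryOn
    (f := fun y : L => y ^ N)
    (fun y hy => (hmem _).2 (by rw [norm_pow, (hmem y).1 hy, one_pow]))
    (fun a ha b hb => by
      rw [hmem] at ha hb
      rw [dist_eq_norm, dist_eq_norm]
      have hb0 : b ≠ 0 := by rintro rfl; simp at hb
      have ha0 : a ≠ 0 := by rintro rfl; simp at ha
      rcases lt_or_ge ‖a - b‖ 1 with h | h
      · exact norm_pow_sub_pow_eq hN hb h
      have hle : ∀ x y : L, ‖x‖ = 1 → ‖y‖ = 1 → ‖x - y‖ ≤ 1 := fun x y hx hy =>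
        by
        rw [sub_eq_add_neg]
        exact (IsUltrametricDist.norm_add_le_max x (-y)).trans (by rw [norm_neg, hx, hy, max_self])
      rw [le_antisymm (hle a b ha hb) h]
      refine le_antisymm (hle _ _ (by simp [ha]) (by simp [hb])) ?_
      by_contra hlt
      push Not at hlt
      rw [norm_sub_eq_norm_div_sub_one (by simp [hb]), ← div_pow] at hlt
      obtain ⟨z, hz, hz1⟩ := exists_pow_eq_one_of_norm_pow_sub_one_lt_one hN
        (u := a / b) (by simp [ha, hb]) hlt
      rw [hroot z hz] at hz1
      have := norm_inv_sub_one_lt_one hz1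
      rw [one_div, inv_inv, ← norm_sub_eq_norm_div_sub_one hb] at this
      linarith) ((hmem u).2 hu)
  exact ⟨v, hv⟩

end Ultrametric

/-- A tame automorphism that moves every element by a relatively small amount is trivial. -/
theorem ringEquiv_apply_eq_self_of_norm_sub_lt {L : Type*} [NormedField L] [IsUltrametricDist L]
    (σ : L ≃+* L) {m : ℕ} (hm : ‖(m : L)‖ = 1)
    (hσm : σ ^ m = 1) (hlt : ∀ x : L, x ≠ 0 → ‖σ x - x‖ < ‖x‖) (x : L) : σ x = x := by
  have hlti : ∀ (i : ℕ) (x : L), x ≠ 0 → ‖(σ ^ i) x - x‖ < ‖x‖ := by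
    intro i x hx
    induction i with
    | zero => simpa using hx
    | succ i ih =>
      have hne : (σ ^ i) x ≠ 0 := (map_ne_zero_iff _ (σ ^ i).injective).2 hx
      have heq : ‖(σ ^ i) x‖ = ‖x‖ := by
        have := IsUltrametricDist.norm_add_eq_max_of_norm_ne_norm ih.ne
        rwa [sub_add_cancel, max_eq_right ih.le] at this
      have : (σ ^ (i + 1)) x - x = (σ ((σ ^ i) x) - (σ ^ i) x) + ((σ ^ i) x - x) := by
        rw [pow_succ', RingAut.mul_apply]; ring
      rw [this]
      refine (IsUltrametricDist.norm_add_le_max _ _).trans_lt (max_lt ?_ ih)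
      rw [← heq]
      exact hlt _ hne
  have hm0 : (m : L) ≠ 0 := by intro h; rw [h] at hm; simp at hm
  set S : L := ∑ i ∈ Finset.range m, (σ ^ i) x with hSdef
  have hS : σ S = S := by
    rw [hSdef, map_sum]
    have h1 := Finset.sum_range_succ' (fun i => (σ ^ i) x) m
    have h2 := Finset.sum_range_succ (fun i => (σ ^ i) x) m
    rw [hσm] at h2
    rw [h2] at h1
    simp only [pow_zero, pow_succ', RingAut.mul_apply, add_left_inj] at h1
    exact h1.symm
  have hSi : ∀ i : ℕ, (σ ^ i) S = S := by
    intro i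
    induction i with
    | zero => simp
    | succ i ih => rw [pow_succ', RingAut.mul_apply, ih, hS]
  -- This element has trace zero over the powers of `σ`, yet that trace differs from `m` times the
  -- element by less than its norm.
  have hy : (m : L) * x - S = 0 := by
    by_contra hne
    have h1 : ∑ i ∈ Finset.range m, (σ ^ i) ((m : L) * x - S) = 0 := by
      simp only [map_sub, map_mul, map_natCast, hSi, Finset.sum_sub_distrib, ← Finset.mul_sum]
      simp [hSdef]
    have h2 : ‖∑ i ∈ Finset.range m, ((σ ^ i) ((m : L) * x - S) - ((m : L) * x - S))‖
        < ‖(m : L) * x - S‖ :=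
      norm_sum_lt_of_forall_lt (norm_pos_iff.2 hne) fun i _ => hlti i _ hne
    rw [Finset.sum_sub_distrib, h1, zero_sub, norm_neg, Finset.sum_const, Finset.card_range,
      nsmul_eq_mul, norm_mul, hm, one_mul] at h2
    exact lt_irrefl _ h2
  have h3 : (m : L) * x = S := sub_eq_zero.1 hy
  have h4 : (m : L) * σ x = m * x := by
    rw [h3]
    conv_rhs => rw [← hS, ← h3]
    simp
  exact mul_left_cancel₀ hm0 h4


/-! ### Residues of units and the action of isometries on them. -/

section ResidueField

theorem exists_finite_forall_norm_sub_lt_one (L : Type*) [NormedField L] [ProperSpace L] :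
    ∃ t : Set L, t.Finite ∧ ∀ x : L, ‖x‖ ≤ 1 → ∃ y ∈ t, ‖x - y‖ < 1 := by
  obtain ⟨t, -, ht, hcov⟩ := (isCompact_closedBall (0 : L) 1).finite_cover_balls one_pos
  refine ⟨t, ht, fun x hx => ?_⟩
  have := hcov (mem_closedBall_zero_iff.2 hx)
  simpa [dist_eq_norm] using this

variable {L : Type*} [NormedField L] [IsUltrametricDist L]

theorem ncard_le_ncard_of_norm_sub_lt_one_imp_eq {S : Set L} (hS : ∀ x ∈ S, ‖x‖ ≤ 1)
 {t : Set L} (ht : t.Finite)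
    (hcov : ∀ x : L, ‖x‖ ≤ 1 → ∃ y ∈ t, ‖x - y‖ < 1)
    (hsep : ∀ x ∈ S, ∀ y ∈ S, ‖x - y‖ < 1 → x = y) : S.ncard ≤ t.ncard := by
  choose! f hf hfx using hcov
  refine Set.ncard_le_ncard_of_injOn f (fun x hx => hf x (hS x hx)) (fun x hx y hy hxy => ?_) ht
  refine hsep x hx y hy ?_
  have h1 := hfx x (hS x hx)
  have h2 := hfx y (hS y hy)
  rw [norm_sub_rev] at h2
  rw [hxy] at h1
  rw [← sub_add_sub_cancel x (f y) y]
  exact (IsUltrametricDist.norm_add_le_max _ _).trans_lt (max_lt h1 h2)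

theorem mem_integer_normedField_valuation {x : L} :
    x ∈ (NormedField.valuation (K := L)).integer ↔ ‖x‖ ≤ 1 := by
  rw [Valuation.mem_integer_iff, NormedField.valuation_apply, ← NNReal.coe_le_coe]
  simp

theorem residue_integer_eq_iff {x y : (NormedField.valuation (K := L)).integer} :
    IsLocalRing.residue _ x = IsLocalRing.residue _ y ↔ ‖(x : L) - y‖ < 1 := by
  rw [← sub_eq_zero, ← map_sub, IsLocalRing.residue_eq_zero_iff, IsLocalRing.mem_maximalIdeal,
    mem_nonunits_iff, Valuation.Integer.not_isUnit_iff_valuation_lt_one,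
    NormedField.valuation_apply, ← NNReal.coe_lt_coe]
  simp

instance finite_residueField_integer_of_properSpace [ProperSpace L] :
    Finite (IsLocalRing.ResidueField (NormedField.valuation (K := L)).integer) := by
  obtain ⟨t, ht, hcov⟩ := exists_finite_forall_norm_sub_lt_one L
  have hsurj := IsLocalRing.residue_surjective (R := (NormedField.valuation (K := L)).integer)
  choose g hg using hsurj
  have : ∀ a, ∃ y ∈ t, ‖(g a : L) - y‖ < 1 := fun a =>
    hcov _ (mem_integer_normedField_valuation.1 (g a).2)
  choose f hf hfx using this
  have := ht.to_subtype
  refine Finite.of_injective (fun a => (⟨f a, hf a⟩ : t)) fun a b hab => ?_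
  have hab' : f a = f b := congrArg Subtype.val hab
  rw [← hg a, ← hg b, residue_integer_eq_iff, ← sub_add_sub_cancel _ (f b)]
  refine (IsUltrametricDist.norm_add_le_max _ _).trans_lt (max_lt ?_ ?_)
  · rw [← hab']; exact hfx a
  · rw [norm_sub_rev]; exact hfx b

theorem norm_zpow_sub_zpow_lt_one {x y : L} (hy : ‖y‖ = 1) (h : ‖x - y‖ < 1) (k : ℤ) :
    ‖x ^ k - y ^ k‖ < 1 := by
  rw [norm_sub_eq_norm_div_sub_one hy] at h
  rw [norm_sub_eq_norm_div_sub_one (by simp [hy]), ← div_zpow]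
  cases k with
  | ofNat i => simpa using norm_pow_sub_one_lt_one h i
  | negSucc i =>
    rw [zpow_negSucc]
    exact norm_inv_sub_one_lt_one (norm_pow_sub_one_lt_one h _)

variable [ProperSpace L]

/-- An isometric automorphism acts on residues of units by a power map. -/
theorem exists_norm_apply_sub_pow_lt_one (σ : L ≃+* L) (hσ : ∀ x, ‖σ x‖ = ‖x‖) :
    ∃ k : ℤ, ∀ x : L, ‖x‖ = 1 → ‖σ x - x ^ k‖ < 1 := by
  let R := (NormedField.valuation (K := L)).integer
  have hmem : ∀ x : R, σ x ∈ R := fun x => by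
    rw [mem_integer_normedField_valuation, hσ]
    exact mem_integer_normedField_valuation.1 x.2
  let f : R →+* R := (σ.toRingHom.comp R.subtype).codRestrict R hmem
  have hf : ∀ x, (f x : L) = σ x := fun x => rfl
  have : IsLocalHom f := ⟨fun x hx => by
    by_contra hnu
    rw [Valuation.Integer.not_isUnit_iff_valuation_lt_one, NormedField.valuation_apply,
      ← NNReal.coe_lt_coe, coe_nnnorm] at hnu
    rw [← hσ, ← hf] at hnu
    have : ¬ IsUnit (f x) := by
      rw [Valuation.Integer.not_isUnit_iff_valuation_lt_one, NormedField.valuation_apply,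
        ← NNReal.coe_lt_coe, coe_nnnorm]
      exact hnu
    exact this hx⟩
  -- The unit group of the finite residue field is cyclic, so each of its endomorphisms is a power
  -- map.
  obtain ⟨k, hk⟩ := MonoidHom.map_cyclic (Units.map (IsLocalRing.ResidueField.map f :
      IsLocalRing.ResidueField R →* IsLocalRing.ResidueField R))
  refine ⟨k, fun x hx => ?_⟩
  have hx0 : x ≠ 0 := by rintro rfl; simp at hx
  let u : Rˣ := ⟨⟨x, mem_integer_normedField_valuation.2 hx.le⟩,
    ⟨x⁻¹, mem_integer_normedField_valuation.2 (by simp [hx])⟩,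
    Subtype.ext (by simp [hx0]), Subtype.ext (by simp [hx0])⟩
  have h1 := congrArg Units.val (hk (Units.map (IsLocalRing.residue R : R →* _) u))
  rw [← map_zpow] at h1
  simp only [Units.coe_map] at h1
  have h2 : IsLocalRing.residue R (f u) = IsLocalRing.residue R ((u ^ k : Rˣ) : R) := h1
  rw [residue_integer_eq_iff] at h2
  have h3 : (((u ^ k : Rˣ) : R) : L) = x ^ k := by
    have := congrArg Units.val (map_zpow (Units.map (R.subtype : R →* L)) u k)
    rwa [Units.val_zpow_eq_zpow_val] at this
  rwa [h3] at h2

/-- Power maps commute; this replaces commutativity of the residue Galois group. -/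
theorem norm_apply_apply_sub_lt_one (σ τ : L ≃+* L) (hσ : ∀ x, ‖σ x‖ = ‖x‖)
    (hτ : ∀ x, ‖τ x‖ = ‖x‖) {x : L} (hx : ‖x‖ = 1) : ‖σ (τ x) - τ (σ x)‖ < 1 := by
  obtain ⟨k, hk⟩ := exists_norm_apply_sub_pow_lt_one σ hσ
  obtain ⟨l, hl⟩ := exists_norm_apply_sub_pow_lt_one τ hτ
  have h1 := hk (τ x) (by rw [hτ, hx])
  have h2 := hl (σ x) (by rw [hσ, hx])
  have h3 := norm_zpow_sub_zpow_lt_one (by rw [norm_zpow, hx, one_zpow]) (hl x hx) k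
  have h4 := norm_zpow_sub_zpow_lt_one (by rw [norm_zpow, hx, one_zpow]) (hk x hx) l
  have : σ (τ x) - τ (σ x) = (σ (τ x) - τ x ^ k) + (τ x ^ k - (x ^ l) ^ k)
      + -((τ (σ x) - σ x ^ l) + (σ x ^ l - (x ^ k) ^ l)) := by
    rw [← zpow_mul, ← zpow_mul, mul_comm l k]; ring
  rw [this]
  refine (IsUltrametricDist.norm_add_le_max _ _).trans_lt (max_lt ?_ ?_)
  · exact (IsUltrametricDist.norm_add_le_max _ _).trans_lt (max_lt h1 h3)
  · rw [norm_neg]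
    exact (IsUltrametricDist.norm_add_le_max _ _).trans_lt (max_lt h2 h4)

end ResidueField

/-! ### Tame rotations: roots of unity and eigenvectors. -/

section Tame

variable {L : Type*} [NormedField L] [IsUltrametricDist L]

/-- Trivial action on residues turns the cocycle `i ↦ (r ^ i) x / x` into the homomorphism `i ↦ u ^
i` modulo one-units. -/
theorem norm_pow_apply_div_sub_one_lt_one {r : L ≃+* L} (hr : ∀ x, ‖r x‖ = ‖x‖)
    (htriv : ∀ x, ‖x‖ = 1 → ‖r x / x - 1‖ < 1) {x u : L} (hx : x ≠ 0) (hu : r x = u * x)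
    (i : ℕ) : ‖(r ^ i) x / (x * u ^ i) - 1‖ < 1 := by
  have hu1 : ‖u‖ = 1 := by
    have := hr x
    rw [hu, norm_mul] at this
    exact (mul_eq_right₀ (norm_ne_zero_iff.2 hx)).1 this
  have hu0 : u ≠ 0 := by rintro rfl; simp at hu1
  have hru0 : r u ≠ 0 := by simpa using hu0
  induction i with
  | zero => simp [hx]
  | succ i ih =>
    have h1 : ‖r ((r ^ i) x / (x * u ^ i)) - 1‖ < 1 := by
      rwa [← map_one r, ← map_sub, hr]
    have h2 := norm_pow_sub_one_lt_one (htriv u hu1) i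
    have h3 : (r ^ (i + 1)) x / (x * u ^ (i + 1))
        = r ((r ^ i) x / (x * u ^ i)) * (r u / u) ^ i := by
      rw [pow_succ', RingAut.mul_apply, map_div₀, map_mul, map_pow, hu, div_pow]
      field_simp
      ring
    rw [h3]
    exact norm_mul_sub_one_lt_one h1 h2

variable [ProperSpace L]

/-- If an involution inverts an isometry of odd order, the latter acts trivially on residues. -/
theorem norm_apply_div_sub_one_lt_one {N : ℕ} (hN : Odd N) {r s : L ≃+* L}
    (hr : ∀ x, ‖r x‖ = ‖x‖) (hs : ∀ x, ‖s x‖ = ‖x‖) (hrN : r ^ N = 1)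
    (hsr : s * r * s⁻¹ = r⁻¹) {x : L} (hx : ‖x‖ = 1) : ‖r x / x - 1‖ < 1 := by
  obtain ⟨k, hk⟩ := hN
  have hiso : ∀ (i : ℕ) x, ‖(r ^ i) x‖ = ‖x‖ := by
    intro i x
    induction i with
    | zero => simp
    | succ i ih => rw [pow_succ', RingAut.mul_apply, hr, ih]
  set t := r ^ (k + 1) with ht
  have htt : t * t = r := by
    rw [ht, ← pow_add, show k + 1 + (k + 1) = N + 1 by omega, pow_succ, hrN, one_mul]
  have hst : s * t * s⁻¹ = t⁻¹ := by
    rw [ht, ← conj_pow, hsr, inv_pow]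
  have hcomm : t * s * t⁻¹ * s⁻¹ = r := by
    have h1 : s * t⁻¹ * s⁻¹ = t := by
      rw [← conj_inv, hst, inv_inv]
    rw [mul_assoc t s, mul_assoc t, h1, htt]
  have hsinv : ∀ x, ‖s⁻¹ x‖ = ‖x‖ := fun x => by
    rw [← hs (s⁻¹ x), ← RingAut.mul_apply, mul_inv_cancel, RingAut.one_apply]
  have htinv : ∀ x, ‖t⁻¹ x‖ = ‖x‖ := fun x => by
    rw [← hiso (k + 1) (t⁻¹ x), ← ht, ← RingAut.mul_apply, mul_inv_cancel, RingAut.one_apply]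
  have h := norm_apply_apply_sub_lt_one t s (hiso _) hs (x := t⁻¹ (s⁻¹ x)) (by
    rw [htinv, hsinv, hx])
  have e1 : s (t (t⁻¹ (s⁻¹ x))) = x := by
    rw [← RingAut.mul_apply t, mul_inv_cancel, RingAut.one_apply, ← RingAut.mul_apply,
      mul_inv_cancel, RingAut.one_apply]
  have e2 : t (s (t⁻¹ (s⁻¹ x))) = r x := by
    rw [← hcomm]; rfl
  rw [e1, e2, norm_sub_eq_norm_div_sub_one hx] at h
  exact h

/-- Let `r` be an isometry of order `ℓ ^ (k + 1)` prime to the residue characteristic, inverted by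
an isometric involution `s`. Then the field has a primitive `ℓ ^ (k + 1)`-th root of unity
which is fixed by `r` and inverted by `s`, and which is an eigenvalue of `r`. -/
theorem exists_isPrimitiveRoot_of_isometry {ℓ k : ℕ} (hℓ : ℓ.Prime) (hodd : Odd ℓ)
    (hnorm : ‖(ℓ : L)‖ = 1) {r s : L ≃+* L} (hr : ∀ x, ‖r x‖ = ‖x‖) (hs : ∀ x, ‖s x‖ = ‖x‖)
    (hrN : r ^ (ℓ ^ (k + 1)) = 1) (hrne : r ^ (ℓ ^ k) ≠ 1) (hsr : s * r * s⁻¹ = r⁻¹) :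
    ∃ Z : L, IsPrimitiveRoot Z (ℓ ^ (k + 1)) ∧ r Z = Z ∧ s Z = Z⁻¹ ∧
      ∃ b : L, b ≠ 0 ∧ r b = Z * b := by
  have htriv : ∀ x, ‖x‖ = 1 → ‖r x / x - 1‖ < 1 := fun x hx =>
    norm_apply_div_sub_one_lt_one hodd.pow hr hs hrN hsr hx
  set N := ℓ ^ (k + 1) with hNdef
  have hNnorm : ‖(N : L)‖ = 1 := by rw [hNdef]; push_cast; rw [norm_pow, hnorm, one_pow]
  -- Otherwise `r ^ (ℓ ^ k)`, whose `ℓ`-th power is trivial, would move everything relatively little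
  -- and be the identity.
  obtain ⟨x, hx0, hx⟩ : ∃ x : L, x ≠ 0 ∧ ‖x‖ ≤ ‖(r ^ (ℓ ^ k)) x - x‖ := by
    by_contra! hcon
    refine hrne (RingEquiv.ext fun x => ?_)
    exact ringEquiv_apply_eq_self_of_norm_sub_lt _ hnorm
      (by rw [← pow_mul, ← pow_succ]; exact hrN) hcon x
  obtain ⟨u, hu⟩ : ∃ u, r x = u * x := ⟨r x / x, by field_simp⟩
  have hu1 : ‖u‖ = 1 := by
    have := hr x
    rw [hu, norm_mul] at this
    exact (mul_eq_right₀ (norm_ne_zero_iff.2 hx0)).1 this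
  have hu0 : u ≠ 0 := by rintro rfl; simp at hu1
  have hpow := norm_pow_apply_div_sub_one_lt_one hr htriv hx0 hu
  have huN : ‖u ^ N - 1‖ < 1 := by
    have h1 := norm_inv_sub_one_lt_one (hpow N)
    rw [hrN, RingAut.one_apply, inv_div, mul_div_cancel_left₀ _ hx0] at h1
    exact h1
  have huk : ¬ ‖u ^ (ℓ ^ k) - 1‖ < 1 := by
    intro h
    have h1 := norm_mul_sub_one_lt_one (hpow (ℓ ^ k)) h
    have h2 : (r ^ (ℓ ^ k)) x / (x * u ^ (ℓ ^ k)) * u ^ (ℓ ^ k) = (r ^ (ℓ ^ k)) x / x := by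
      field_simp
    rw [h2, div_sub_one hx0, norm_div, div_lt_one (norm_pos_iff.2 hx0)] at h1
    linarith
  obtain ⟨Z, hZN, hZu⟩ := exists_pow_eq_one_of_norm_pow_sub_one_lt_one hNnorm hu1 huN
  have hZ0 : Z ≠ 0 := by
    rintro rfl
    rw [zero_pow (pow_ne_zero _ hℓ.ne_zero)] at hZN
    exact zero_ne_one hZN
  have hZ1 : ‖Z‖ = 1 := by
    have := norm_eq_one_of_norm_sub_one_lt_one hZu
    rwa [norm_div, hu1, div_one] at this
  have hprim : IsPrimitiveRoot Z N := by
    have : Fact ℓ.Prime := ⟨hℓ⟩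
    have hord : orderOf Z = N := by
      refine orderOf_eq_prime_pow ?_ hZN
      intro h
      refine huk ?_
      have := norm_inv_sub_one_lt_one (norm_pow_sub_one_lt_one hZu (ℓ ^ k))
      rwa [div_pow, h, one_div, inv_inv] at this
    rw [← hord]
    exact IsPrimitiveRoot.orderOf Z
  have hsu0 : s u ≠ 0 := by simpa using hu0
  refine ⟨Z, hprim, ?_, ?_, ?_⟩
  · have h1 := eq_one_of_pow_eq_one_of_norm_sub_one_lt_one hNnorm (htriv Z hZ1)
      (by rw [div_pow, ← map_pow, hZN, map_one, div_one])
    exact (div_eq_one_iff_eq hZ0).1 h1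
  · have hsZ : ‖s Z / s u - 1‖ < 1 := by
      rwa [← map_div₀, ← map_one s, ← map_sub, hs]
    have hrinv : ∀ x, ‖x‖ = 1 → ‖r⁻¹ x / x - 1‖ < 1 := by
      intro x hx
      have hx' : ‖r⁻¹ x‖ = 1 := by
        rw [← hr, ← RingAut.mul_apply, mul_inv_cancel, RingAut.one_apply, hx]
      have h1 := norm_inv_sub_one_lt_one (htriv _ hx')
      rwa [← RingAut.mul_apply, mul_inv_cancel, RingAut.one_apply, inv_div] at h1
    have hsx0 : s x ≠ 0 := by simpa using hx0
    have hw : ‖s x / x‖ = 1 := by rw [norm_div, hs, div_self (norm_ne_zero_iff.2 hx0)]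
    have hsr' : s (r x) = r⁻¹ (s x) := by
      rw [← hsr]
      simp [RingAut.mul_apply]
    have h1 : r⁻¹ u * r⁻¹ x = x := by
      rw [← map_mul, ← hu, ← RingAut.mul_apply, inv_mul_cancel, RingAut.one_apply]
    have h1' : r⁻¹ u ≠ 0 := left_ne_zero_of_mul (h1.trans_ne hx0)
    have h2' : r⁻¹ x ≠ 0 := right_ne_zero_of_mul (h1.trans_ne hx0)
    -- Both `s x` and `x` are moved by `r⁻¹` by the same factor modulo one-units, since their ratio
    -- is a unit; these factors are `s u` and `u⁻¹`.
    have hsuu : ‖s u * u - 1‖ < 1 := by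
      have h2 : s u * u = (r⁻¹ (s x / x) / (s x / x)) * (r⁻¹ u / u)⁻¹ := by
        have h3 : s u = r⁻¹ (s x) / s x := by
          rw [← hsr', hu, map_mul, mul_div_cancel_right₀ _ hsx0]
        have h4 : r⁻¹ x = x / r⁻¹ u := by rw [eq_div_iff h1', mul_comm, h1]
        rw [h3, map_div₀, h4]
        field_simp
      rw [h2]
      exact norm_mul_sub_one_lt_one (hrinv _ hw) (norm_inv_sub_one_lt_one (hrinv _ hu1))
    have h5 : ‖s Z * Z - 1‖ < 1 := by
      have : s Z * Z = (s Z / s u * (Z / u)) * (s u * u) := by field_simp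
      rw [this]
      exact norm_mul_sub_one_lt_one (norm_mul_sub_one_lt_one hsZ hZu) hsuu
    have h6 := eq_one_of_pow_eq_one_of_norm_sub_one_lt_one hNnorm h5
      (by rw [mul_pow, ← map_pow, hZN, map_one, one_mul])
    exact eq_inv_of_mul_eq_one_left h6
  · have hrZ : r Z = Z := by
      have h1 := eq_one_of_pow_eq_one_of_norm_sub_one_lt_one hNnorm (htriv Z hZ1)
        (by rw [div_pow, ← map_pow, hZN, map_one, div_one])
      exact (div_eq_one_iff_eq hZ0).1 h1
    -- A Lagrange resolvent. Each summand is `x` times a one-unit, so the sum divided by `x` has the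
    -- norm of `N`, namely 1, and cannot vanish.
    refine ⟨∑ i ∈ Finset.range N, (Z ^ i)⁻¹ * (r ^ i) x, ?_, ?_⟩
    · have h1 : ∀ i, ‖(Z ^ i)⁻¹ * (r ^ i) x / x - 1‖ < 1 := by
        intro i
        have h2 : (Z ^ i)⁻¹ * (r ^ i) x / x = (r ^ i) x / (x * u ^ i) * ((Z / u) ^ i)⁻¹ := by
          rw [div_pow]; field_simp
        rw [h2]
        exact norm_mul_sub_one_lt_one (hpow i)
          (norm_inv_sub_one_lt_one (norm_pow_sub_one_lt_one hZu i))
      have h3 := norm_sum_eq_one_of_norm_sub_one_lt_one hNnorm h1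
      rw [← Finset.sum_div] at h3
      intro h4
      rw [h4, zero_div, norm_zero] at h3
      exact zero_ne_one h3
    · rw [map_sum, Finset.mul_sum]
      have h1 : ∀ i, r ((Z ^ i)⁻¹ * (r ^ i) x) = Z * ((Z ^ (i + 1))⁻¹ * (r ^ (i + 1)) x) := by
        intro i
        rw [map_mul, map_inv₀, map_pow, hrZ, pow_succ' r, RingAut.mul_apply, pow_succ' Z, mul_inv,
          ← mul_assoc, mul_inv_cancel_left₀ hZ0]
      simp only [h1]
      rw [← Finset.mul_sum, ← Finset.mul_sum]
      congr 1
      have h2 := Finset.sum_range_succ' (fun i => (Z ^ i)⁻¹ * (r ^ i) x) N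
      have h3 := Finset.sum_range_succ (fun i => (Z ^ i)⁻¹ * (r ^ i) x) N
      rw [h3, hrN, hZN] at h2
      simpa using h2.symm

end Tame

/-! ### From an eigenvector to a root of the uniformizer. -/

/-- In the situation of a primitive root of unity `Z` fixed by `r` and inverted by the involution
`s`, where `r` and `s` together have fixed field `K`, an eigenvector of `r` with eigenvalue `Z`
yields a root of the uniformizer. -/
theorem exists_pow_eq_uniformizer {K L : Type*} [NormedField K] [IsUltrametricDist K]
    [ProperSpace K] [Field L] [Algebra K L] {π : K} (hπ0 : π ≠ 0)
    (hπ : ∀ x : K, x ≠ 0 → ∃ j : ℤ, ‖x‖ = ‖π‖ ^ j)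
    {ℓ k : ℕ} (hℓ : ℓ.Prime) (hodd : Odd ℓ) (hnorm : ‖(ℓ : K)‖ = 1) {r s : L ≃+* L}
    (hrK : ∀ x : K, r (algebraMap K L x) = algebraMap K L x)
    (hsK : ∀ x : K, s (algebraMap K L x) = algebraMap K L x)
    (hfix : ∀ x : L, r x = x → s x = x → ∃ y : K, algebraMap K L y = x)
    (hsr : s * r * s⁻¹ = r⁻¹) (hss : s * s = 1) {Z b : L}
    (hZ : IsPrimitiveRoot Z (ℓ ^ (k + 1))) (hrZ : r Z = Z) (hsZ : s Z = Z⁻¹)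
    (hb : b ≠ 0) (hrb : r b = Z * b) :
    ∃ α : L, α ^ (ℓ ^ (k + 1)) = algebraMap K L π := by
  set N := ℓ ^ (k + 1) with hNdef
  have hNpos : 0 < N := pow_pos hℓ.pos _
  have hNodd : Odd N := hodd.pow
  have hNnorm : ‖(N : K)‖ = 1 := by rw [hNdef]; push_cast; rw [norm_pow, hnorm, one_pow]
  have hZ0 : Z ≠ 0 := hZ.ne_zero hNpos.ne'
  have hπL : algebraMap K L π ≠ 0 := by simpa using hπ0
  have hmuZ : ∀ z : L, z ^ N = 1 → r z = z := by
    intro z hz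
    have : NeZero N := ⟨hNpos.ne'⟩
    obtain ⟨i, -, rfl⟩ := hZ.eq_pow_of_pow_eq_one hz
    rw [map_pow, hrZ]
  -- Such a `z` is a power of `Z`, so `s` both fixes and inverts it; a root of unity of odd order
  -- with square 1 is 1.
  have hroot : ∀ z : K, z ^ N = 1 → z = 1 := by
    intro z hz
    have : NeZero N := ⟨hNpos.ne'⟩
    obtain ⟨i, -, hi⟩ := hZ.eq_pow_of_pow_eq_one (ξ := algebraMap K L z)
      (by rw [← map_pow, hz, map_one])
    have h1 := hsK z
    rw [← hi, map_pow, hsZ, inv_pow, hi, ← map_inv₀] at h1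
    have h2 := (algebraMap K L).injective h1
    have hz0 : z ≠ 0 := by rintro rfl; rw [zero_pow hNpos.ne'] at hz; exact zero_ne_one hz
    have h3 : z ^ 2 = 1 := by
      rw [pow_two]; nth_rewrite 1 [← h2]; exact inv_mul_cancel₀ hz0
    obtain ⟨m, hm⟩ := hNodd
    rwa [hm, pow_add, pow_mul, h3, one_pow, one_mul, pow_one] at hz
  have hsb0 : s b ≠ 0 := by simpa using hb
  have hrsb : r (s b) = Z * s b := by
    have h1 : s⁻¹ = s := inv_eq_of_mul_eq_one_left hss
    have h2 : r * s = s * r⁻¹ := by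
      rw [← hsr, h1, ← mul_assoc, ← mul_assoc, hss, one_mul]
    have h3 : r⁻¹ b = Z⁻¹ * b := by
      have : r (Z⁻¹ * b) = b := by
        rw [map_mul, map_inv₀, hrZ, hrb, inv_mul_cancel_left₀ hZ0]
      conv_lhs => rw [← this]
      rw [← RingAut.mul_apply, inv_mul_cancel, RingAut.one_apply]
    rw [← RingAut.mul_apply, h2, RingAut.mul_apply, h3, map_mul, map_inv₀, hsZ, inv_inv]
  have hssb : s (s b) = b := by rw [← RingAut.mul_apply, hss, RingAut.one_apply]
  have hrc : r (b * s b) = Z ^ 2 * (b * s b) := by rw [map_mul, hrb, hrsb]; ring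
  have hc0 : b * s b ≠ 0 := mul_ne_zero hb hsb0
  obtain ⟨C, hC⟩ := hfix ((b * s b) ^ N)
    (by rw [map_pow, hrc, mul_pow, ← pow_mul, mul_comm 2, pow_mul, hZ.pow_eq_one, one_pow,
      one_mul])
    (by rw [map_pow, map_mul, hssb, mul_comm])
  have hC0 : C ≠ 0 := by
    rintro rfl
    rw [map_zero] at hC
    exact pow_ne_zero _ hc0 hC.symm
  obtain ⟨j, hj⟩ := hπ C hC0
  have hπj : π ^ j ≠ 0 := zpow_ne_zero _ hπ0
  obtain ⟨v, hv⟩ := exists_pow_eq_of_norm_eq_one hNnorm hroot (u := C / π ^ j)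
    (by rw [norm_div, hj, norm_zpow, div_self]; rw [← norm_zpow]; exact norm_ne_zero_iff.2 hπj)
  have hv0 : v ≠ 0 := by
    rintro rfl
    rw [zero_pow hNpos.ne'] at hv
    exact div_ne_zero hC0 hπj hv.symm
  have hvL : algebraMap K L v ≠ 0 := by simpa using hv0
  obtain ⟨c, hcdef⟩ : ∃ c, c = b * s b / algebraMap K L v := ⟨_, rfl⟩
  have hcN : c ^ N = algebraMap K L π ^ j := by
    rw [hcdef, div_pow, ← hC, ← map_pow, hv, ← map_div₀, div_div_cancel₀ hC0, map_zpow₀]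
  have hc0' : c ≠ 0 := by rw [hcdef]; exact div_ne_zero hc0 hvL
  have hrc' : r c = Z ^ 2 * c := by rw [hcdef, map_div₀, hrc, hrK, mul_div_assoc]
  -- Otherwise `c ^ (ℓ ^ k)` is an element of `K` times a power of `Z`, hence fixed by `r`; but `r`
  -- multiplies it by `Z ^ (2 * ℓ ^ k)`, which is not 1 as `ℓ` is odd.
  have hjℓ : ¬ (ℓ : ℤ) ∣ j := by
    rintro ⟨j', rfl⟩
    have h1 : (c ^ (ℓ ^ k) / algebraMap K L π ^ j') ^ ℓ = 1 := by
      rw [div_pow, ← pow_mul, ← pow_succ, hcN, ← zpow_natCast, ← zpow_mul, mul_comm j',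
        div_self (zpow_ne_zero _ hπL)]
    have h2 := hmuZ _ (by rw [hNdef, pow_succ', pow_mul, h1, one_pow] :
      (c ^ (ℓ ^ k) / algebraMap K L π ^ j') ^ N = 1)
    have h3 : r (algebraMap K L π ^ j') = algebraMap K L π ^ j' := by
      rw [map_zpow₀, hrK]
    rw [map_div₀, h3, map_pow, hrc', mul_pow] at h2
    have h4 : (Z ^ 2) ^ (ℓ ^ k) = 1 := by
      have := (div_left_inj' (zpow_ne_zero _ hπL)).1 h2
      exact (mul_eq_right₀ (pow_ne_zero _ hc0')).1 this
    rw [← pow_mul] at h4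
    have h5 := hZ.dvd_of_pow_eq_one _ h4
    rw [hNdef, pow_succ'] at h5
    have h6 := Nat.dvd_of_mul_dvd_mul_right (pow_pos hℓ.pos _) h5
    have h7 := Nat.le_of_dvd two_pos h6
    have h8 : ℓ = 2 := le_antisymm h7 hℓ.two_le
    rw [h8] at hodd
    exact absurd hodd (by decide)
  have hcop : IsCoprime j (N : ℤ) := by
    rw [hNdef]; push_cast
    refine IsCoprime.pow_right ?_
    exact ((Nat.prime_iff_prime_int.1 hℓ).coprime_iff_not_dvd.2 hjℓ).symm
  obtain ⟨x, y, hxy⟩ := hcop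
  refine ⟨c ^ x * algebraMap K L π ^ y, ?_⟩
  rw [mul_pow, ← zpow_natCast, ← zpow_natCast, ← zpow_mul, mul_comm x, zpow_mul, zpow_natCast,
    hcN, ← zpow_mul, ← zpow_mul, ← zpow_add₀ hπL, mul_comm j, hxy, zpow_one]

/-! ### Recognising a dihedral group. -/

section DihedralGroup

theorem nonempty_mulEquiv_dihedralGroup {G : Type*} [Group G] {N : ℕ} [NeZero N] {r s : G}
    (hr : r ^ N = 1) (hs : s * s = 1) (hsr : s * r * s⁻¹ = r⁻¹)
    (hgen : ∀ g : G, ∃ i : ℕ, g = r ^ i ∨ g = s * r ^ i) (hcard : Nat.card G = 2 * N) :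
    Nonempty (G ≃* DihedralGroup N) := by
  let f : ZMod N →+ Additive G :=
    ZMod.lift N ⟨zmultiplesHom (Additive G) (Additive.ofMul r), by
      rw [zmultiplesHom_apply, natCast_zsmul, ← ofMul_pow, hr, ofMul_one]⟩
  let t : ZMod N → G := fun i => (f i).toMul
  have hadd : ∀ i j, t (i + j) = t i * t j := fun i j => by simp only [t, map_add, toMul_add]
  have hsub : ∀ i j, t (j - i) = (t i)⁻¹ * t j := fun i j => by
    rw [eq_inv_mul_iff_mul_eq, ← hadd, add_sub_cancel]
  have hint : ∀ i : ℤ, t i = r ^ i := fun i => by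
    simp only [t, f, ZMod.lift_coe, zmultiplesHom_apply, toMul_zsmul, toMul_ofMul]
  have hst : ∀ i, t i * s = s * (t i)⁻¹ := fun i => by
    obtain ⟨i, rfl⟩ := ZMod.intCast_surjective i
    have h1 : s * r ^ i * s⁻¹ = (r ^ i)⁻¹ := by rw [← conj_zpow, hsr, inv_zpow]
    have h2 : s⁻¹ = s := inv_eq_of_mul_eq_one_left hs
    rw [hint, ← h1, h2, ← mul_assoc, ← mul_assoc, hs, one_mul]
  let φ : DihedralGroup N →* G :=
    { toFun := fun g => match g with
        | .r i => t i
        | .sr i => s * t i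
      map_one' := by
        change t 0 = 1
        simp only [t, map_zero, toMul_zero]
      map_mul' := by
        rintro (i | i) (j | j)
        · exact hadd i j
        · change s * t (j - i) = t i * (s * t j)
          rw [hsub, ← mul_assoc, ← mul_assoc, hst]
        · change s * t (i + j) = s * t i * t j
          rw [hadd, mul_assoc]
        · change t (j - i) = s * t i * (s * t j)
          rw [hsub, mul_assoc, ← mul_assoc (t i), hst, mul_assoc, ← mul_assoc s s, hs, one_mul] }
  have hsurj : Function.Surjective φ := by
    intro g
    obtain ⟨i, rfl | rfl⟩ := hgen g
    · refine ⟨.r (i : ℤ), ?_⟩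
      change t (i : ℤ) = _
      rw [hint, zpow_natCast]
    · refine ⟨.sr (i : ℤ), ?_⟩
      change s * t (i : ℤ) = _
      rw [hint, zpow_natCast]
  have hbij : Function.Bijective φ :=
    (Nat.bijective_iff_surjective_and_card φ).2 ⟨hsurj, by rw [DihedralGroup.nat_card, hcard]⟩
  exact ⟨(MulEquiv.ofBijective φ hbij).symm⟩

end DihedralGroup

/-! ### Kummer extensions with dihedral Galois group. -/

section KummerDihedral

/-- By counting: the images of `ζ` and `α` determine an automorphism and take at most `2 * N`
values, so every admissible pair occurs, in particular those defining a rotation and a reflection.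
-/
theorem nonempty_aut_mulEquiv_dihedralGroup {K F : Type*} [Field K] [Field F] [Algebra K F]
    [FiniteDimensional K F] [IsGalois K F] {N : ℕ} [NeZero N]
    (hfin : Module.finrank K F = 2 * N) {ζ α : F} (hζ : IsPrimitiveRoot ζ N) {a : K}
    (ha : a ≠ 0) (hα : α ^ N = algebraMap K F a)
    (hinj : ∀ σ τ : F ≃ₐ[K] F, σ ζ = τ ζ → σ α = τ α → σ = τ)
    (hσζ : ∀ σ : F ≃ₐ[K] F, σ ζ = ζ ∨ σ ζ = ζ⁻¹) :
    Nonempty ((F ≃ₐ[K] F) ≃* DihedralGroup N) := by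
  classical
  have hN0 : N ≠ 0 := NeZero.ne N
  have hζ0 : ζ ≠ 0 := hζ.ne_zero hN0
  have hα0 : α ≠ 0 := by
    rintro rfl
    rw [zero_pow hN0] at hα
    exact ha ((map_eq_zero _).1 hα.symm)
  have hcard : Nat.card (F ≃ₐ[K] F) = 2 * N := (IsGalois.card_aut_eq_finrank K F).trans hfin
  let T : Finset (F × F) := {ζ, ζ⁻¹} ×ˢ (Finset.range N).image fun i => ζ ^ i * α
  have hTcard : T.card ≤ 2 * N := by
    rw [Finset.card_product]
    refine Nat.mul_le_mul Finset.card_le_two ?_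
    exact Finset.card_image_le.trans (Finset.card_range N).le
  have hσα : ∀ σ : F ≃ₐ[K] F, ∃ i < N, σ α = ζ ^ i * α := by
    intro σ
    obtain ⟨i, hi, hi'⟩ := hζ.eq_pow_of_pow_eq_one (ξ := σ α / α)
      (by rw [div_pow, ← map_pow, hα, AlgEquiv.commutes, div_self]; simpa using ha)
    exact ⟨i, hi, by rw [hi', div_mul_cancel₀ _ hα0]⟩
  let e : (F ≃ₐ[K] F) → F × F := fun σ => (σ ζ, σ α)
  have heinj : Function.Injective e := fun σ τ h =>
    hinj σ τ (congrArg Prod.fst h) (congrArg Prod.snd h)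
  have himg : Finset.univ.image e = T := by
    refine Finset.eq_of_subset_of_card_le ?_ ?_
    · intro x hx
      obtain ⟨σ, -, rfl⟩ := Finset.mem_image.1 hx
      obtain ⟨i, hi, hi'⟩ := hσα σ
      refine Finset.mem_product.2 ⟨?_, Finset.mem_image.2 ⟨i, Finset.mem_range.2 hi, hi'.symm⟩⟩
      simpa [e] using hσζ σ
    · rw [Finset.card_image_of_injective _ heinj, Finset.card_univ, ← Nat.card_eq_fintype_card,
        hcard]
      exact hTcard
  have hex : ∀ z : F, (z = ζ ∨ z = ζ⁻¹) → ∀ i < N, ∃ σ : F ≃ₐ[K] F, σ ζ = z ∧ σ α = ζ ^ i * α := by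
    intro z hz i hi
    have : (z, ζ ^ i * α) ∈ T :=
      Finset.mem_product.2 ⟨by simpa using hz, Finset.mem_image.2 ⟨i, Finset.mem_range.2 hi, rfl⟩⟩
    rw [← himg] at this
    obtain ⟨σ, -, hσ⟩ := Finset.mem_image.1 this
    exact ⟨σ, congrArg Prod.fst hσ, congrArg Prod.snd hσ⟩
  obtain ⟨r, hrζ, hrα⟩ : ∃ r : F ≃ₐ[K] F, r ζ = ζ ∧ r α = ζ * α := by
    -- The exponent is reduced modulo `N` to allow `N = 1`.
    obtain ⟨r, h1, h2⟩ := hex ζ (Or.inl rfl) (1 % N) (Nat.mod_lt _ (Nat.pos_of_ne_zero hN0))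
    refine ⟨r, h1, h2.trans ?_⟩
    rw [hζ.eq_orderOf, pow_mod_orderOf, pow_one]
  obtain ⟨s, hsζ, hsα⟩ : ∃ s : F ≃ₐ[K] F, s ζ = ζ⁻¹ ∧ s α = α := by
    obtain ⟨s, h1, h2⟩ := hex ζ⁻¹ (Or.inr rfl) 0 (Nat.pos_of_ne_zero hN0)
    exact ⟨s, h1, by simpa using h2⟩
  have hriζ : ∀ i : ℕ, (r ^ i) ζ = ζ := by
    intro i
    induction i with
    | zero => simp
    | succ i ih => rw [pow_succ', AlgEquiv.mul_apply, ih, hrζ]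
  have hriα : ∀ i : ℕ, (r ^ i) α = ζ ^ i * α := by
    intro i
    induction i with
    | zero => simp
    | succ i ih =>
      rw [pow_succ', AlgEquiv.mul_apply, ih, map_mul, map_pow, hrζ, hrα, pow_succ, mul_assoc]
  have hss : s * s = 1 := by
    refine hinj _ _ ?_ ?_
    · rw [AlgEquiv.mul_apply, hsζ, map_inv₀, hsζ, inv_inv, AlgEquiv.one_apply]
    · rw [AlgEquiv.mul_apply, hsα, hsα, AlgEquiv.one_apply]
  refine nonempty_mulEquiv_dihedralGroup (r := r) (s := s) ?_ hss ?_ ?_ hcard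
  · refine hinj _ _ ?_ ?_
    · rw [hriζ, AlgEquiv.one_apply]
    · rw [hriα, hζ.pow_eq_one, one_mul, AlgEquiv.one_apply]
  · rw [inv_eq_of_mul_eq_one_left hss, eq_inv_iff_mul_eq_one]
    refine hinj _ _ ?_ ?_
    · simp only [AlgEquiv.mul_apply, AlgEquiv.one_apply, hrζ, hsζ, map_inv₀, inv_inv]
    · simp only [AlgEquiv.mul_apply, AlgEquiv.one_apply, hrα, hsα, hsζ, hrζ, map_mul, map_inv₀]
      rw [inv_mul_cancel_left₀]
      simpa using hζ0
  · intro g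
    obtain ⟨i, hi, hgα⟩ := hσα g
    rcases hσζ g with h | h
    · refine ⟨i, Or.inl (hinj _ _ ?_ ?_)⟩
      · rw [h, hriζ]
      · rw [hgα, hriα]
    · refine ⟨N - i, Or.inr (hinj _ _ ?_ ?_)⟩
      · rw [h, AlgEquiv.mul_apply, hriζ, hsζ]
      · rw [hgα, AlgEquiv.mul_apply, hriα, map_mul, map_pow, hsζ, hsα]
        congr 1
        rw [inv_pow]
        refine eq_inv_of_mul_eq_one_left ?_
        rw [← pow_add, Nat.add_sub_cancel' hi.le, hζ.pow_eq_one]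

theorem adjoin_primitiveRoot_le {K Ω : Type*} [Field K] [Field Ω] [Algebra K Ω] {m : ℕ}
    [NeZero m] {ρ ρ' : Ω} (hρ : IsPrimitiveRoot ρ m) (hρ' : ρ' ^ m = 1) : K⟮ρ'⟯ ≤ K⟮ρ⟯ := by
  obtain ⟨i, -, rfl⟩ := hρ.eq_pow_of_pow_eq_one hρ'
  rw [IntermediateField.adjoin_simple_le_iff]
  exact pow_mem (IntermediateField.mem_adjoin_simple_self K ρ) i

/-- If `σ` moves `ζ`, the constant term of its quadratic minimal polynomial is `σ ζ * ζ`, an `N`-th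
root of unity in `K` and so 1. -/
theorem apply_eq_or_eq_inv_of_natDegree_le_two {K E : Type*} [Field K] [Field E] [Algebra K E]
    {N : ℕ} [NeZero N] (hroot : ∀ z : K, z ^ N = 1 → z = 1) {ζ : E} (hζ : ζ ^ N = 1)
    (hint : IsIntegral K ζ) (hdeg : (minpoly K ζ).natDegree ≤ 2) (σ : E →ₐ[K] E) :
    σ ζ = ζ ∨ σ ζ = ζ⁻¹ := by
  have htwo := minpoly.two_le_natDegree_iff hint
  have hquad := Polynomial.eq_quadratic_of_degree_le_two (p := minpoly K ζ)
    (Polynomial.natDegree_le_iff_degree_le.1 hdeg)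
  have hmonic := minpoly.monic hint
  have h1 : Polynomial.aeval ζ (minpoly K ζ) = 0 := minpoly.aeval K ζ
  generalize minpoly K ζ = p at *
  have h2 : Polynomial.aeval (σ ζ) p = 0 := by
    rw [Polynomial.aeval_algHom_apply, h1, map_zero]
  rcases lt_or_eq_of_le hdeg with hlt | heq
  · left
    obtain ⟨x, hx⟩ : ζ ∈ (algebraMap K E).range := by
      by_contra h
      exact absurd (htwo.2 h) (by omega)
    rw [← hx, AlgHom.commutes]
  have hc2 : p.coeff 2 = 1 := by
    rw [← heq]; exact hmonic
  rw [hquad, hc2] at h1 h2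
  simp only [map_one, map_add, map_mul, map_pow, Polynomial.aeval_X, Polynomial.aeval_C,
    one_mul] at h1 h2
  by_cases hne : σ ζ = ζ
  · exact Or.inl hne
  right
  have h3 : (σ ζ - ζ) * (σ ζ + ζ + algebraMap K E (p.coeff 1)) = 0 := by
    linear_combination h2 - h1
  have h4 := (mul_eq_zero.1 h3).resolve_left (sub_ne_zero.2 hne)
  have h5 : σ ζ * ζ = algebraMap K E (p.coeff 0) := by
    linear_combination ζ * h4 - h1
  have h6 : p.coeff 0 = 1 := by
    apply hroot
    apply (algebraMap K E).injective
    rw [map_pow, ← h5, mul_pow, ← map_pow, hζ, map_one, map_one, one_mul]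
  rw [h6, map_one] at h5
  exact eq_inv_of_mul_eq_one_left h5

theorem eq_one_of_pow_prime_pow_eq_one {M : Type*} [Monoid M] {ℓ : ℕ}
    (h : ∀ z : M, z ^ ℓ = 1 → z = 1) (m : ℕ) {z : M} (hz : z ^ (ℓ ^ m) = 1) : z = 1 := by
  induction m with
  | zero => simpa using hz
  | succ m ih => exact ih (h _ (by rw [← pow_mul, ← pow_succ, hz]))

theorem eq_one_of_pow_eq_one_of_finrank_ne_one {K Ω : Type*} [Field K] [Field Ω] [Algebra K Ω]
    {ℓ : ℕ} (hℓ : ℓ.Prime) {ρ : Ω} (hρ : ρ ^ ℓ = 1) (hfin : Module.finrank K K⟮ρ⟯ ≠ 1) {z : K}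
    (hz : z ^ ℓ = 1) : z = 1 := by
  by_contra hne
  have : NeZero ℓ := ⟨hℓ.ne_zero⟩
  have : Fact ℓ.Prime := ⟨hℓ⟩
  have hprim : IsPrimitiveRoot z ℓ := by
    have := IsPrimitiveRoot.orderOf z
    rwa [orderOf_eq_prime hz hne] at this
  have hle := adjoin_primitiveRoot_le (K := K)
    (hprim.map_of_injective (algebraMap K Ω).injective) hρ
  rw [IntermediateField.adjoin_simple_eq_bot_iff.2 ((⊥ : IntermediateField K Ω).algebraMap_mem z),
    le_bot_iff] at hle
  exact hfin (IntermediateField.finrank_eq_one_iff.2 hle)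

theorem isDihedralExtension_adjoin {K Ω : Type*} [Field K] [Field Ω] [Algebra K Ω]
    [IsAlgClosure K Ω] {ℓ k : ℕ} (hℓ : ℓ.Prime) (hodd : Odd ℓ) (hℓK : (ℓ : K) ≠ 0) {π : K}
    (hirr : Irreducible (Polynomial.X ^ (ℓ ^ (k + 1)) - Polynomial.C π)) {ρ : Ω}
    (hρ : IsPrimitiveRoot ρ ℓ) (hfin : Module.finrank K K⟮ρ⟯ = 2) {ζ : Ω} (hζmem : ζ ∈ K⟮ρ⟯)
    (hζ : IsPrimitiveRoot ζ (ℓ ^ (k + 1))) {α : Ω}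
    (hα : α ^ (ℓ ^ (k + 1)) = algebraMap K Ω π) :
    IsDihedralExtension K K⟮ρ, α⟯ ∧ Module.finrank K K⟮ρ, α⟯ = 2 * ℓ ^ (k + 1) := by
  have : IsAlgClosed Ω := IsAlgClosure.isAlgClosed K
  have : Algebra.IsAlgebraic K Ω := IsAlgClosure.isAlgebraic
  have : NeZero ℓ := ⟨hℓ.ne_zero⟩
  set N := ℓ ^ (k + 1) with hNdef
  have hN0 : N ≠ 0 := pow_ne_zero _ hℓ.ne_zero
  have : NeZero N := ⟨hN0⟩
  have hNodd : Odd N := hodd.pow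
  have hN2 : 2 ≤ N := hℓ.two_le.trans (Nat.le_self_pow (Nat.succ_ne_zero k) ℓ)
  have hπ0 : π ≠ 0 := by
    rintro rfl
    rw [map_zero, sub_zero] at hirr
    exact not_irreducible_pow (by omega) hirr
  have hα0 : α ≠ 0 := by
    rintro rfl
    rw [zero_pow hN0] at hα
    exact hπ0 ((map_eq_zero _).1 hα.symm)
  have hmono := Polynomial.monic_X_pow_sub_C π hN0
  have hmin : minpoly K α = Polynomial.X ^ N - Polynomial.C π :=
    (minpoly.eq_of_irreducible_of_monic hirr (by simp [hα]) hmono).symm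
  have hαint : IsIntegral K α := Algebra.IsIntegral.isIntegral α
  have hfinα : Module.finrank K K⟮α⟯ = N := by
    rw [IntermediateField.adjoin.finrank hαint, hmin, Polynomial.natDegree_X_pow_sub_C]
  have hρint : IsIntegral K ρ := Algebra.IsIntegral.isIntegral ρ
  have hsup : K⟮ρ, α⟯ = K⟮ρ⟯ ⊔ K⟮α⟯ := by
    rw [← IntermediateField.adjoin_union, Set.singleton_union]
  have hfd : FiniteDimensional K K⟮ρ, α⟯ := by
    have := IntermediateField.adjoin.finiteDimensional hρint
    have := IntermediateField.adjoin.finiteDimensional hαint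
    rw [hsup]
    infer_instance
  have hρle : K⟮ρ⟯ ≤ K⟮ρ, α⟯ := by rw [hsup]; exact le_sup_left
  have hαle : K⟮α⟯ ≤ K⟮ρ, α⟯ := by rw [hsup]; exact le_sup_right
  have hfinF : Module.finrank K K⟮ρ, α⟯ = 2 * N := by
    have hdvd : 2 * N ∣ Module.finrank K K⟮ρ, α⟯ := by
      refine Nat.Coprime.mul_dvd_of_dvd_of_dvd (Nat.coprime_two_left.2 hNodd) ?_ ?_
      · rw [← hfin]; exact IntermediateField.finrank_dvd_of_le_right hρle
      · rw [← hfinα]; exact IntermediateField.finrank_dvd_of_le_right hαle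
    refine le_antisymm ?_ (Nat.le_of_dvd Module.finrank_pos hdvd)
    rw [← hfin, ← hfinα, hsup]
    exact IntermediateField.finrank_sup_le _ _
  have hζα : K⟮ζ⟯ = K⟮ρ⟯ := by
    refine le_antisymm ?_ ?_
    · rwa [IntermediateField.adjoin_simple_le_iff]
    · exact adjoin_primitiveRoot_le hζ (by rw [hNdef, pow_succ', pow_mul, hρ.pow_eq_one, one_pow])
  have hroot : ∀ z : K, z ^ N = 1 → z = 1 := fun z hz =>
    eq_one_of_pow_prime_pow_eq_one (fun w hw => eq_one_of_pow_eq_one_of_finrank_ne_one hℓ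
      hρ.pow_eq_one (by rw [hfin]; decide) hw) (k + 1) hz
  -- The roots are the `ζ ^ i * α`; the quotient of two of them recovers `ζ`, and with it `ρ`.
  have hsplit : Polynomial.IsSplittingField K K⟮ρ, α⟯ (Polynomial.X ^ N - Polynomial.C π) := by
    rw [IntermediateField.isSplittingField_iff]
    have hset : ∀ x : Ω, x ∈ (Polynomial.X ^ N - Polynomial.C π).rootSet Ω ↔
        ∃ i : ℕ, x = ζ ^ i * α := by
      intro x
      rw [Polynomial.mem_rootSet]
      simp only [map_sub, map_pow, Polynomial.aeval_X, Polynomial.aeval_C, sub_eq_zero]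
      constructor
      · rintro ⟨-, hx⟩
        obtain ⟨i, -, hi⟩ := hζ.eq_pow_of_pow_eq_one (ξ := x / α)
          (by rw [div_pow, hx, hα, div_self]; simpa using hπ0)
        exact ⟨i, by rw [hi, div_mul_cancel₀ _ hα0]⟩
      · rintro ⟨i, rfl⟩
        refine ⟨hmono.ne_zero, ?_⟩
        rw [mul_pow, ← pow_mul, mul_comm i, pow_mul, hζ.pow_eq_one, one_pow, one_mul, hα]
    have hmem : ∀ x ∈ (Polynomial.X ^ N - Polynomial.C π).rootSet Ω, x ∈ K⟮ρ, α⟯ := by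
      intro x hx
      obtain ⟨i, rfl⟩ := (hset x).1 hx
      exact mul_mem (pow_mem (hρle hζmem) i)
        (hαle (IntermediateField.mem_adjoin_simple_self K α))
    refine ⟨(IntermediateField.splits_iff_mem (IsAlgClosed.splits _)).2 hmem,
      le_antisymm ?_ (IntermediateField.adjoin_le_iff.2 hmem)⟩
    have h1 : α ∈ IntermediateField.adjoin K
        ((Polynomial.X ^ N - Polynomial.C π).rootSet Ω) :=
      IntermediateField.subset_adjoin _ _ ((hset α).2 ⟨0, by simp⟩)
    have h2 : ζ * α ∈ IntermediateField.adjoin K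
        ((Polynomial.X ^ N - Polynomial.C π).rootSet Ω) :=
      IntermediateField.subset_adjoin _ _ ((hset _).2 ⟨1, by simp⟩)
    have h3 := div_mem h2 h1
    rw [mul_div_cancel_right₀ _ hα0, ← IntermediateField.adjoin_simple_le_iff, hζα,
      IntermediateField.adjoin_simple_le_iff] at h3
    rw [IntermediateField.adjoin_le_iff, Set.insert_subset_iff, Set.singleton_subset_iff]
    exact ⟨h3, h1⟩
  have hsep : (Polynomial.X ^ N - Polynomial.C π).Separable :=
    Polynomial.separable_X_pow_sub_C π (by rw [hNdef]; push_cast; exact pow_ne_zero _ hℓK) hπ0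
  have hgal : IsGalois K K⟮ρ, α⟯ := IsGalois.of_separable_splitting_field hsep
  refine ⟨⟨hgal, N, hN2, ?_⟩, hfinF⟩
  let ζ' : K⟮ρ, α⟯ := ⟨ζ, hρle hζmem⟩
  let α' : K⟮ρ, α⟯ := ⟨α, hαle (IntermediateField.mem_adjoin_simple_self K α)⟩
  have hζ' : IsPrimitiveRoot ζ' N := by
    rw [← IsPrimitiveRoot.coe_submonoidClass_iff]; exact hζ
  refine nonempty_aut_mulEquiv_dihedralGroup hfinF (ζ := ζ') (α := α') (a := π) hζ' hπ0
    (Subtype.ext (by simpa [α'] using hα)) ?_ ?_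
  · intro σ τ h1 h2
    obtain ⟨i, -, hi⟩ := hζ.eq_pow_of_pow_eq_one (ξ := ρ)
      (by rw [hNdef, pow_succ', pow_mul, hρ.pow_eq_one, one_pow])
    have : (σ : K⟮ρ, α⟯ →ₐ[K] K⟮ρ, α⟯) = τ := by
      refine IntermediateField.algHom_ext_of_eq_adjoin K rfl ?_
      rintro x (rfl | rfl)
      · have hx : ∀ hx, (⟨x, hx⟩ : K⟮x, α⟯) = ζ' ^ i := fun hx => Subtype.ext hi.symm
        rw [hx]
        simp only [map_pow, AlgEquiv.coe_toAlgHom, h1]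
      · exact h2
    exact AlgEquiv.ext fun x => DFunLike.congr_fun this x
  · intro σ
    refine apply_eq_or_eq_inv_of_natDegree_le_two hroot hζ'.pow_eq_one
      (Algebra.IsIntegral.isIntegral ζ') ?_ (σ : K⟮ρ, α⟯ →ₐ[K] K⟮ρ, α⟯)
    rw [← minpoly.algHom_eq K⟮ρ, α⟯.val K⟮ρ, α⟯.val.injective]
    change (minpoly K ζ).natDegree ≤ 2
    rw [← IntermediateField.adjoin.finrank (Algebra.IsIntegral.isIntegral ζ), hζα, hfin]

end KummerDihedral

/-! ### Finite extensions with the spectral norm. -/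

section NormedExtension

variable {K L : Type*} [NontriviallyNormedField K] [IsUltrametricDist K] [ProperSpace K]

theorem isUltrametricDist_of_normedAlgebra (K L : Type*) [NontriviallyNormedField K]
    [IsUltrametricDist K] [CompleteSpace K] [NormedField L] [NormedAlgebra K L]
    [FiniteDimensional K L] : IsUltrametricDist L := by
  refine IsUltrametricDist.isUltrametricDist_of_isNonarchimedean_norm fun x y => ?_
  simp only [NormedAlgebra.norm_eq_spectralNorm K]
  exact isNonarchimedean_spectralNorm x y

theorem norm_algEquiv_apply [NormedField L] [NormedAlgebra K L]
    [FiniteDimensional K L] (σ : L ≃ₐ[K] L) (x : L) : ‖σ x‖ = ‖x‖ := by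
  rw [NormedAlgebra.norm_eq_spectralNorm K, NormedAlgebra.norm_eq_spectralNorm K x]
  exact (spectralNorm_eq_of_equiv σ x).symm

/-- Distinct roots of unity of order prime to the residue characteristic have distinct residues, so
a finite cover by unit balls bounds `ℓ ^ k`, hence `k`. -/
theorem exists_bound_of_isPrimitiveRoot_prime_pow_of_normedAlgebra [NormedField L]
    [NormedAlgebra K L] [FiniteDimensional K L] {ℓ : ℕ} (hℓ : ℓ.Prime) (hnorm : ‖(ℓ : K)‖ = 1) :
    ∃ M : ℕ, ∀ k : ℕ, (∃ ζ : L, IsPrimitiveRoot ζ (ℓ ^ k)) → k ≤ M := by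
  have : ProperSpace L := FiniteDimensional.proper K L
  have : IsUltrametricDist L := isUltrametricDist_of_normedAlgebra K L
  obtain ⟨t, ht, hcov⟩ := exists_finite_forall_norm_sub_lt_one L
  refine ⟨t.ncard, ?_⟩
  rintro k ⟨ζ, hζ⟩
  have hN : ‖((ℓ ^ k : ℕ) : L)‖ = 1 := by
    rw [← map_natCast (algebraMap K L), norm_algebraMap']
    push_cast
    rw [norm_pow, hnorm, one_pow]
  have hpos : 0 < ℓ ^ k := pow_pos hℓ.pos k
  have hone : ∀ x : L, x ^ ℓ ^ k = 1 → ‖x‖ = 1 := fun x hx => by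
    have := congrArg norm hx
    rw [norm_pow, norm_one] at this
    exact (pow_eq_one_iff_of_nonneg (norm_nonneg x) hpos.ne').1 this
  have hmain := ncard_le_ncard_of_norm_sub_lt_one_imp_eq (S := {x : L | x ^ ℓ ^ k = 1})
    (fun x hx => (hone x hx).le) ht hcov (fun x hx y hy hxy => by
      have hy1 := hone y hy
      have hy0 : y ≠ 0 := by rintro rfl; simp at hy1
      rw [norm_sub_eq_norm_div_sub_one hy1] at hxy
      exact (div_eq_one_iff_eq hy0).1 (eq_one_of_pow_eq_one_of_norm_sub_one_lt_one hN hxy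
        (by rw [div_pow, show x ^ ℓ ^ k = 1 from hx, show y ^ ℓ ^ k = 1 from hy, div_one])))
  have hcard : {x : L | x ^ ℓ ^ k = 1}.ncard = ℓ ^ k := by
    classical
    have : {x : L | x ^ ℓ ^ k = 1} = Polynomial.nthRootsFinset (ℓ ^ k) (1 : L) := by
      ext x
      simp [Polynomial.mem_nthRootsFinset hpos]
    rw [this, Set.ncard_coe_finset, hζ.card_nthRootsFinset]
  rw [hcard] at hmain
  exact (Nat.lt_pow_self hℓ.one_lt).le.trans hmain

theorem exists_bound_of_isPrimitiveRoot_prime_pow (K L : Type*) [NontriviallyNormedField K]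
    [IsUltrametricDist K] [ProperSpace K] [Field L] [Algebra K L] [FiniteDimensional K L]
    {ℓ : ℕ} (hℓ : ℓ.Prime) (hnorm : ‖(ℓ : K)‖ = 1) :
    ∃ M : ℕ, ∀ k : ℕ, (∃ ζ : L, IsPrimitiveRoot ζ (ℓ ^ k)) → k ≤ M :=
  letI := spectralNorm.normedField K L
  letI := spectralNorm.normedAlgebra K L
  exists_bound_of_isPrimitiveRoot_prime_pow_of_normedAlgebra (K := K) (L := L) hℓ hnorm

theorem exists_isPrimitiveRoot_of_algEquiv_of_normedAlgebra [NormedField L] [NormedAlgebra K L]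
    [FiniteDimensional K L] {ℓ k : ℕ} (hℓ : ℓ.Prime) (hodd : Odd ℓ) (hnorm : ‖(ℓ : K)‖ = 1)
    {r s : L ≃ₐ[K] L} (hrN : r ^ (ℓ ^ (k + 1)) = 1) (hrne : r ^ (ℓ ^ k) ≠ 1)
    (hsr : s * r * s⁻¹ = r⁻¹) :
    ∃ Z : L, IsPrimitiveRoot Z (ℓ ^ (k + 1)) ∧ r Z = Z ∧ s Z = Z⁻¹ ∧
      ∃ b : L, b ≠ 0 ∧ r b = Z * b := by
  have : ProperSpace L := FiniteDimensional.proper K L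
  have : IsUltrametricDist L := isUltrametricDist_of_normedAlgebra K L
  let f : (L ≃ₐ[K] L) →* (L ≃+* L) := MulSemiringAction.toRingAut (L ≃ₐ[K] L) L
  have hf : Function.Injective f := fun σ τ h =>
    AlgEquiv.ext fun x => DFunLike.congr_fun h x
  refine exists_isPrimitiveRoot_of_isometry (r := f r) (s := f s) hℓ hodd
    (by rw [← map_natCast (algebraMap K L), norm_algebraMap', hnorm])
    (norm_algEquiv_apply r) (norm_algEquiv_apply s) ?_ ?_ ?_
  · rw [← map_pow, hrN, map_one]
  · rw [← map_pow, ← map_one f]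
    exact hf.ne hrne
  · rw [← map_inv, ← map_inv, ← map_mul, ← map_mul, hsr]

theorem exists_isPrimitiveRoot_of_algEquiv [Field L] [Algebra K L]
    [FiniteDimensional K L] {ℓ k : ℕ} (hℓ : ℓ.Prime) (hodd : Odd ℓ) (hnorm : ‖(ℓ : K)‖ = 1)
    {r s : L ≃ₐ[K] L} (hrN : r ^ (ℓ ^ (k + 1)) = 1) (hrne : r ^ (ℓ ^ k) ≠ 1)
    (hsr : s * r * s⁻¹ = r⁻¹) :
    ∃ Z : L, IsPrimitiveRoot Z (ℓ ^ (k + 1)) ∧ r Z = Z ∧ s Z = Z⁻¹ ∧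
      ∃ b : L, b ≠ 0 ∧ r b = Z * b :=
  letI := spectralNorm.normedField K L
  letI := spectralNorm.normedAlgebra K L
  exists_isPrimitiveRoot_of_algEquiv_of_normedAlgebra (K := K) (L := L) hℓ hodd hnorm hrN hrne hsr

/-- The quadratic is `X ^ 2 - t * X + 1`; `w` is not in `K`, since being fixed and inverted by `s`
would give it order at most 2. -/
theorem finrank_adjoin_eq_two_of_apply_eq_inv {K L : Type*} [Field K] [Field L] [Algebra K L]
    {s : L ≃ₐ[K] L} {w : L} {N : ℕ} (hN : Odd N) (hw : w ^ N = 1) (hw1 : w ≠ 1) (hsw : s w = w⁻¹)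
    (hadd : ∃ t : K, algebraMap K L t = w + w⁻¹) : Module.finrank K K⟮w⟯ = 2 := by
  obtain ⟨t, ht⟩ := hadd
  have hw0 : w ≠ 0 := by
    rintro rfl
    rw [zero_pow hN.pos.ne'] at hw
    exact zero_ne_one hw
  let q : Polynomial K := Polynomial.X ^ 2 - Polynomial.C t * Polynomial.X + 1
  have hqdeg : q.natDegree = 2 := by
    simp only [q]; compute_degree!
  have hqmonic : q.Monic := by
    simp only [q]; monicity!
  have hq : Polynomial.aeval w q = 0 := by
    simp only [q, map_add, map_sub, map_mul, map_pow, Polynomial.aeval_X, Polynomial.aeval_C,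
      map_one, ht]
    field_simp
    ring
  have hint : IsIntegral K w := ⟨q, hqmonic, hq⟩
  rw [IntermediateField.adjoin.finrank hint]
  refine le_antisymm ?_ ((minpoly.two_le_natDegree_iff hint).2 ?_)
  · rw [← hqdeg]
    exact Polynomial.natDegree_le_of_dvd (minpoly.dvd K w hq) hqmonic.ne_zero
  · rintro ⟨z, hz⟩
    rw [← hz, AlgEquiv.commutes, hz] at hsw
    have h3 : w ^ 2 = 1 := by
      rw [pow_two]; nth_rewrite 1 [hsw]; exact inv_mul_cancel₀ hw0
    obtain ⟨m, hm⟩ := hN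
    rw [hm, pow_add, pow_mul, h3, one_pow, one_mul, pow_one] at hw
    exact hw1 hw

/-- The structure of dihedral extensions of degree `2 * ℓ ^ (k + 1)`. -/
theorem IsDihedralExtension.exists_isPrimitiveRoot_and_pow_eq [Field L] [Algebra K L] {ℓ k : ℕ}
    (hℓ : ℓ.Prime) (hodd : Odd ℓ) (hnorm : ‖(ℓ : K)‖ = 1) {π : K} (hπ0 : π ≠ 0)
    (hπ : ∀ x : K, x ≠ 0 → ∃ j : ℤ, ‖x‖ = ‖π‖ ^ j) (hL : IsDihedralExtension K L)
    (hfin : Module.finrank K L = 2 * ℓ ^ (k + 1)) :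
    ∃ Z α : L, IsPrimitiveRoot Z (ℓ ^ (k + 1)) ∧ α ^ (ℓ ^ (k + 1)) = algebraMap K L π ∧
      Module.finrank K K⟮Z ^ (ℓ ^ k)⟯ = 2 ∧ Z ∈ K⟮Z ^ (ℓ ^ k)⟯ := by
  obtain ⟨hgal, m, hm, ⟨e⟩⟩ := hL
  have hfd : FiniteDimensional K L := FiniteDimensional.of_finrank_pos
    (by rw [hfin]; exact Nat.mul_pos two_pos (pow_pos hℓ.pos _))
  have hmN : m = ℓ ^ (k + 1) := by
    have h1 := IsGalois.card_aut_eq_finrank K L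
    rw [Nat.card_congr e.toEquiv, DihedralGroup.nat_card, hfin] at h1
    omega
  subst hmN
  set N := ℓ ^ (k + 1) with hNdef
  have hNpos : 0 < N := pow_pos hℓ.pos _
  have hNodd : Odd N := hodd.pow
  have : NeZero N := ⟨hNpos.ne'⟩
  let r := e.symm (.r 1)
  let s := e.symm (.sr 0)
  have hrN : r ^ N = 1 := by
    simp only [r]
    rw [← map_pow, DihedralGroup.r_one_pow_n, map_one]
  have hrne : r ^ (ℓ ^ k) ≠ 1 := by
    simp only [r]
    rw [← map_pow, ne_eq, map_eq_one_iff _ e.symm.injective, ← orderOf_dvd_iff_pow_eq_one,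
      DihedralGroup.orderOf_r_one, Nat.pow_dvd_pow_iff_le_right hℓ.one_lt]
    omega
  have hss : s * s = 1 := by
    simp only [s]
    rw [← map_mul, DihedralGroup.sr_mul_self, map_one]
  have hsr : s * r * s⁻¹ = r⁻¹ := by
    simp only [s, r]
    rw [← map_inv, ← map_inv, ← map_mul, ← map_mul]
    simp
  have hfix : ∀ x : L, r x = x → s x = x → ∃ y : K, algebraMap K L y = x := by
    intro x hr hs
    have hri : ∀ i : ℕ, (r ^ i) x = x := fun i => by
      induction i with
      | zero => simp
      | succ i ih => rw [pow_succ', AlgEquiv.mul_apply, ih, hr]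
    refine IntermediateField.mem_bot.1 ((IsGalois.mem_bot_iff_fixed x).2 fun g => ?_)
    obtain ⟨g, rfl⟩ := e.symm.surjective g
    have hrpow : ∀ i : ZMod N, e.symm (.r i) = r ^ i.val := fun i => by
      simp only [r]
      rw [← map_pow, DihedralGroup.r_one_pow, ZMod.natCast_zmod_val]
    rcases g with i | i
    · rw [hrpow, hri]
    · have : e.symm (.sr i) = s * r ^ i.val := by
        rw [← hrpow]
        simp only [s]
        rw [← map_mul, DihedralGroup.sr_mul_r, zero_add]
      rw [this, AlgEquiv.mul_apply, hri, hs]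
  obtain ⟨Z, hZ, hrZ, hsZ, b, hb, hrb⟩ := exists_isPrimitiveRoot_of_algEquiv hℓ hodd hnorm hrN
    hrne hsr
  let f : (L ≃ₐ[K] L) →* (L ≃+* L) := MulSemiringAction.toRingAut (L ≃ₐ[K] L) L
  obtain ⟨α, hα⟩ := exists_pow_eq_uniformizer (r := f r) (s := f s) hπ0 hπ hℓ hodd hnorm
    (fun x => r.commutes x) (fun x => s.commutes x) hfix
    (by rw [← map_inv f s, ← map_inv f r, ← map_mul, ← map_mul, hsr]) (by rw [← map_mul, hss, map_one])
    hZ hrZ hsZ hb hrb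
  -- The sum `Z ^ i + (Z ^ i)⁻¹` is fixed by `r` and `s`. Using this for both `Z` and `Z ^ (ℓ ^ k)`
  -- makes the two nested quadratic fields equal.
  have hfinw : ∀ i : ℕ, Z ^ i ≠ 1 → Module.finrank K K⟮Z ^ i⟯ = 2 := fun i hi =>
    finrank_adjoin_eq_two_of_apply_eq_inv hNodd
      (by rw [← pow_mul, mul_comm, pow_mul, hZ.pow_eq_one, one_pow]) hi
      (by rw [map_pow, hsZ, inv_pow])
      (hfix _ (by rw [map_add, map_inv₀, map_pow, hrZ])
        (by rw [map_add, map_inv₀, map_pow, hsZ, inv_pow, inv_inv, add_comm]))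
  have hZk : Z ^ (ℓ ^ k) ≠ 1 := by
    intro h
    have h1 := hZ.dvd_of_pow_eq_one _ h
    rw [Nat.pow_dvd_pow_iff_le_right hℓ.one_lt] at h1
    omega
  have hZ1 : Z ^ 1 ≠ 1 := by
    intro h
    rw [pow_one] at h
    rw [h, one_pow] at hZk
    exact hZk rfl
  refine ⟨Z, α, hZ, hα, hfinw _ hZk, ?_⟩
  have h1 := hfinw _ hZ1
  rw [pow_one] at h1
  have hle : K⟮Z ^ (ℓ ^ k)⟯ ≤ K⟮Z⟯ := by
    rw [IntermediateField.adjoin_simple_le_iff]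
    exact pow_mem (IntermediateField.mem_adjoin_simple_self K Z) _
  rw [IntermediateField.eq_of_le_of_finrank_eq hle ((hfinw _ hZk).trans h1.symm)]
  exact IntermediateField.mem_adjoin_simple_self K Z

end NormedExtension

/-! ### The classification over a normed field. -/

section NormedMain

variable {K : Type u} [NontriviallyNormedField K]
  {π : K} {ℓ k : ℕ} {Ω : Type v} [Field Ω] [Algebra K Ω] [IsAlgClosure K Ω]

/-- For odd `ℓ` it suffices that `π` is not an `ℓ`-th power, which holds because its exponent in the
value group is 1. -/
theorem irreducible_X_pow_sub_C_uniformizer (hπ0 : π ≠ 0) (hπ1 : ‖π‖ < 1)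
    (hπ : ∀ x : K, x ≠ 0 → ∃ j : ℤ, ‖x‖ = ‖π‖ ^ j) (hℓ : ℓ.Prime) (hodd : Odd ℓ) (n : ℕ) :
    Irreducible (Polynomial.X ^ (ℓ ^ n) - Polynomial.C π) := by
  refine X_pow_sub_C_irreducible_of_prime_pow hℓ ?_ n ?_
  · rintro rfl
    exact absurd hodd (by decide)
  · intro b hb
    have hb0 : b ≠ 0 := by
      rintro rfl
      rw [zero_pow hℓ.ne_zero] at hb
      exact hπ0 hb.symm
    obtain ⟨j, hj⟩ := hπ b hb0
    have h1 := congrArg norm hb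
    rw [norm_pow, hj, ← zpow_natCast, ← zpow_mul] at h1
    nth_rewrite 2 [← zpow_one ‖π‖] at h1
    have h2 := zpow_right_injective₀ (norm_pos_iff.2 hπ0) hπ1.ne h1
    have h3 : (ℓ : ℤ) ∣ 1 := ⟨j, by rw [mul_comm, h2]⟩
    exact hℓ.one_lt.ne' (by exact_mod_cast Int.eq_one_of_dvd_one (by positivity) h3)

variable [IsUltrametricDist K] [ProperSpace K]

theorem IsDihedralExtension.finrank_adjoin_and_nonempty_algEquiv {L : Type w} [Field L]
    [Algebra K L] (hℓ : ℓ.Prime) (hodd : Odd ℓ) (hnorm : ‖(ℓ : K)‖ = 1) (hπ0 : π ≠ 0)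
    (hπ : ∀ x : K, x ≠ 0 → ∃ j : ℤ, ‖x‖ = ‖π‖ ^ j) {ρ : Ω} (hρ : IsPrimitiveRoot ρ ℓ)
    (hL : IsDihedralExtension K L) (hfin : Module.finrank K L = 2 * ℓ ^ (k + 1)) :
    Module.finrank K K⟮ρ⟯ = 2 ∧ (∃ ζ : K⟮ρ⟯, IsPrimitiveRoot ζ (ℓ ^ (k + 1))) ∧
      ∀ α : Ω, α ^ (ℓ ^ (k + 1)) = algebraMap K Ω π →
        Module.finrank K K⟮ρ, α⟯ = 2 * ℓ ^ (k + 1) → Nonempty (L ≃ₐ[K] K⟮ρ, α⟯) := by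
  have : IsAlgClosed Ω := IsAlgClosure.isAlgClosed K
  have : NeZero ℓ := ⟨hℓ.ne_zero⟩
  have : NeZero (ℓ ^ (k + 1)) := ⟨pow_ne_zero _ hℓ.ne_zero⟩
  obtain ⟨Z, β, hZ, hβ, hw, hZw⟩ :=
    hL.exists_isPrimitiveRoot_and_pow_eq hℓ hodd hnorm hπ0 hπ hfin
  have hfd : FiniteDimensional K L := FiniteDimensional.of_finrank_pos
    (by rw [hfin]; exact Nat.mul_pos two_pos (pow_pos hℓ.pos _))
  let φ : L →ₐ[K] Ω := IsAlgClosed.lift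
  have hφ : Function.Injective φ := φ.injective
  have hprimZ : IsPrimitiveRoot (φ Z) (ℓ ^ (k + 1)) := hZ.map_of_injective hφ
  have hprimw : IsPrimitiveRoot (φ (Z ^ ℓ ^ k)) ℓ :=
    (hZ.pow (NeZero.pos _) (pow_succ ℓ k)).map_of_injective hφ
  have heq : K⟮φ (Z ^ ℓ ^ k)⟯ = K⟮ρ⟯ :=
    le_antisymm (adjoin_primitiveRoot_le hρ hprimw.pow_eq_one)
      (adjoin_primitiveRoot_le hprimw hρ.pow_eq_one)
  have hmap : K⟮Z ^ ℓ ^ k⟯.map φ = K⟮ρ⟯ := by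
    rw [IntermediateField.adjoin_map, Set.image_singleton, heq]
  have hZmem : φ Z ∈ K⟮ρ⟯ := by
    rw [← hmap]
    exact ⟨Z, hZw, rfl⟩
  refine ⟨?_, ⟨⟨φ Z, hZmem⟩, IsPrimitiveRoot.coe_submonoidClass_iff.1 hprimZ⟩, ?_⟩
  · rw [← hmap, ← hw]
    exact (LinearEquiv.finrank_eq (IntermediateField.equivMap _ φ).toLinearEquiv).symm
  · intro α hα hfinα
    have hβ0 : φ β ≠ 0 := by
      intro h
      rw [map_eq_zero] at h
      rw [h, zero_pow (NeZero.ne _)] at hβ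
      exact hπ0 ((map_eq_zero _).1 hβ.symm)
    have hle : K⟮ρ, α⟯ ≤ φ.fieldRange := by
      rw [IntermediateField.adjoin_le_iff, Set.insert_subset_iff, Set.singleton_subset_iff]
      constructor
      · have h1 : ρ ∈ K⟮Z ^ ℓ ^ k⟯.map φ := by
          rw [hmap]; exact IntermediateField.mem_adjoin_simple_self K ρ
        obtain ⟨y, -, hy⟩ := h1
        exact ⟨y, hy⟩
      -- Both `α` and `φ β` are `N`-th roots of `π` for `N = ℓ ^ (k + 1)`, so they differ by a power
      -- of `φ Z`, which lies in the image of `L`.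
      · obtain ⟨i, -, hi⟩ := hprimZ.eq_pow_of_pow_eq_one (ξ := α / φ β)
          (by rw [div_pow, ← map_pow, hβ, hα, AlgHom.commutes, div_self]; simpa using hπ0)
        refine ⟨Z ^ i * β, ?_⟩
        change φ (Z ^ i * β) = α
        rw [map_mul, map_pow, hi, div_mul_cancel₀ _ hβ0]
    let e : L ≃ₐ[K] φ.fieldRange := AlgEquiv.ofInjectiveField φ
    have hfd' : FiniteDimensional K φ.fieldRange := LinearEquiv.finiteDimensional e.toLinearEquiv
    have heq' := IntermediateField.eq_of_le_of_finrank_eq hle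
      (by rw [hfinα, ← hfin]; exact LinearEquiv.finrank_eq e.toLinearEquiv)
    exact ⟨e.trans (IntermediateField.equivOfEq heq'.symm)⟩

theorem dihedral_classification_of_normed (hπ0 : π ≠ 0) (hπ1 : ‖π‖ < 1)
    (hπ : ∀ x : K, x ≠ 0 → ∃ j : ℤ, ‖x‖ = ‖π‖ ^ j) (hℓ : ℓ.Prime) (hodd : Odd ℓ)
    (hnorm : ‖(ℓ : K)‖ = 1) (ρ : Ω) (hρ : IsPrimitiveRoot ρ ℓ) :
    ∃ d : ℕ, IsGreatest {k : ℕ | ∃ ζ : K⟮ρ⟯, IsPrimitiveRoot ζ (ℓ ^ k)} d ∧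
      ∀ n : ℕ, 1 ≤ n →
        ((∃ (L : Type v) (_ : Field L) (_ : Algebra K L),
            IsDihedralExtension K L ∧ Module.finrank K L = 2 * ℓ ^ n) ↔
          Module.finrank K K⟮ρ⟯ = 2 ∧ n ≤ d) ∧
        (Module.finrank K K⟮ρ⟯ = 2 ∧ n ≤ d →
          ∀ α : Ω, α ^ (ℓ ^ n) = algebraMap K Ω π →
            IsDihedralExtension K K⟮ρ, α⟯ ∧
            Module.finrank K K⟮ρ, α⟯ = 2 * ℓ ^ n ∧
            ∀ (L : Type w) [Field L] [Algebra K L],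
              IsDihedralExtension K L → Module.finrank K L = 2 * ℓ ^ n →
                Nonempty (L ≃ₐ[K] K⟮ρ, α⟯)) := by
  have : IsAlgClosed Ω := IsAlgClosure.isAlgClosed K
  have : Algebra.IsAlgebraic K Ω := IsAlgClosure.isAlgebraic
  have : FiniteDimensional K K⟮ρ⟯ :=
    IntermediateField.adjoin.finiteDimensional (Algebra.IsIntegral.isIntegral ρ)
  set S := {k : ℕ | ∃ ζ : K⟮ρ⟯, IsPrimitiveRoot ζ (ℓ ^ k)} with hS
  have hbdd : BddAbove S := by
    obtain ⟨M, hM⟩ := exists_bound_of_isPrimitiveRoot_prime_pow K K⟮ρ⟯ hℓ hnorm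
    exact ⟨M, fun k hk => hM k hk⟩
  have hne : S.Nonempty := ⟨0, 1, by rw [pow_zero]; exact IsPrimitiveRoot.one⟩
  have hgreat : IsGreatest S (sSup S) := ⟨Nat.sSup_mem hne hbdd, fun k hk => le_csSup hbdd hk⟩
  have hℓ0 : (ℓ : K) ≠ 0 := by
    intro h
    rw [h, norm_zero] at hnorm
    exact zero_ne_one hnorm
  refine ⟨sSup S, hgreat, fun n hn => ?_⟩
  obtain ⟨k, rfl⟩ : ∃ k, n = k + 1 := ⟨n - 1, by omega⟩
  have hkey : Module.finrank K K⟮ρ⟯ = 2 ∧ k + 1 ≤ sSup S →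
      ∀ α : Ω, α ^ (ℓ ^ (k + 1)) = algebraMap K Ω π →
        IsDihedralExtension K K⟮ρ, α⟯ ∧ Module.finrank K K⟮ρ, α⟯ = 2 * ℓ ^ (k + 1) := by
    rintro ⟨hfin, hle⟩ α hα
    obtain ⟨ζ, hζ⟩ := hgreat.1
    -- A suitable `ℓ`-power of the root of maximal order has exact order `ℓ ^ (k + 1)`.
    have hζ' := (hζ.pow (pow_pos hℓ.pos _) (a := ℓ ^ (sSup S - (k + 1))) (b := ℓ ^ (k + 1))
      (by rw [← pow_add, Nat.sub_add_cancel hle]))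
    exact isDihedralExtension_adjoin hℓ hodd hℓ0
      (irreducible_X_pow_sub_C_uniformizer hπ0 hπ1 hπ hℓ hodd _) hρ hfin (SetLike.coe_mem _)
      (IsPrimitiveRoot.coe_submonoidClass_iff.2 hζ') hα
  refine ⟨⟨?_, fun h => ?_⟩, fun h α hα => ?_⟩
  · rintro ⟨L, _, _, hL, hfin⟩
    obtain ⟨h1, h2, -⟩ :=
      hL.finrank_adjoin_and_nonempty_algEquiv hℓ hodd hnorm hπ0 hπ hρ hfin
    exact ⟨h1, hgreat.2 h2⟩
  · obtain ⟨α, hα⟩ := IsAlgClosed.exists_pow_nat_eq (algebraMap K Ω π) (pow_pos hℓ.pos (k + 1))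
    obtain ⟨h1, h2⟩ := hkey h α hα
    exact ⟨K⟮ρ, α⟯, inferInstance, inferInstance, h1, h2⟩
  · obtain ⟨h1, h2⟩ := hkey h α hα
    refine ⟨h1, h2, fun L _ _ hL hfin => ?_⟩
    exact (hL.finrank_adjoin_and_nonempty_algEquiv hℓ hodd hnorm hπ0 hπ hρ hfin).2.2 α hα h2

end NormedMain

/-! ### From the valuation to a norm. -/

theorem valuation_natCast_eq_one_of_ne_ringChar {K : Type*} [Field K] [ValuativeRel K] {ℓ : ℕ}
    (hℓ : ℓ.Prime) (hchar : ℓ ≠ ringChar 𝓀[K]) : ValuativeRel.valuation K (ℓ : K) = 1 := by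
  have hne : ((ℓ : ℕ) : 𝓀[K]) ≠ 0 := by
    intro h
    rcases (Nat.dvd_prime hℓ).1 ((ringChar.spec 𝓀[K] ℓ).1 h) with h1 | h1
    · exact CharP.ringChar_ne_one h1
    · exact hchar h1.symm
  rw [← map_natCast (IsLocalRing.residue 𝒪[K]), IsLocalRing.residue_ne_zero_iff_isUnit] at hne
  have := (Valuation.integer.integers (ValuativeRel.valuation K)).isUnit_iff_valuation_eq_one.1 hne
  simpa using this

theorem exists_valuation_eq_zpow_of_irreducible {K : Type*} [Field K] [ValuativeRel K]
    [IsDiscreteValuationRing 𝒪[K]] {π : 𝒪[K]} (hπ : Irreducible π) {x : K} (hx : x ≠ 0) :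
    ∃ j : ℤ, ValuativeRel.valuation K x = ValuativeRel.valuation K (π : K) ^ j := by
  have hpow : ∀ y : 𝒪[K], y ≠ 0 → ∃ j : ℕ,
      ValuativeRel.valuation K (y : K) = ValuativeRel.valuation K (π : K) ^ j := by
    intro y hy
    obtain ⟨j, u, rfl⟩ := IsDiscreteValuationRing.eq_unit_mul_pow_irreducible hy hπ
    have := (Valuation.integer.integers (ValuativeRel.valuation K)).isUnit_iff_valuation_eq_one.1
      u.isUnit
    refine ⟨j, ?_⟩
    have h2 : ValuativeRel.valuation K ((u : 𝒪[K]) : K) = 1 := this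
    push_cast
    rw [map_mul, h2, one_mul, map_pow]
  rcases le_total (ValuativeRel.valuation K x) 1 with h | h
  · obtain ⟨j, hj⟩ := hpow ⟨x, h⟩ (fun h0 => hx (congrArg Subtype.val h0))
    exact ⟨j, by rw [zpow_natCast]; exact hj⟩
  · have h' : ValuativeRel.valuation K x⁻¹ ≤ 1 := by
      rw [map_inv₀]; exact inv_le_one_of_one_le₀ h
    obtain ⟨j, hj⟩ := hpow ⟨x⁻¹, h'⟩ (fun h0 => inv_ne_zero hx (congrArg Subtype.val h0))
    refine ⟨-j, ?_⟩
    rw [zpow_neg, zpow_natCast, ← hj, map_inv₀, inv_inv]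

theorem mainTheorem11
    {K₀ : Type u} [Field K₀] [ValuativeRel K₀] [TopologicalSpace K₀]
    [IsNonarchimedeanLocalField K₀]
    (h2 : ringChar 𝓀[K₀] ≠ 2)
    (π : 𝒪[K₀]) (hπ : Irreducible π)
    (ℓ : ℕ) (hℓ : ℓ.Prime) (hℓodd : Odd ℓ) (hℓchar : ℓ ≠ ringChar 𝓀[K₀])
    {Ω : Type v} [Field Ω] [Algebra K₀ Ω] [IsAlgClosure K₀ Ω]
    (ρ : Ω) (hρ : IsPrimitiveRoot ρ ℓ) :
    ∃ d : ℕ, IsGreatest {k : ℕ | ∃ ζ : K₀⟮ρ⟯, IsPrimitiveRoot ζ (ℓ ^ k)} d ∧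
      ∀ n : ℕ, 1 ≤ n →
        ((∃ (L : Type v) (_ : Field L) (_ : Algebra K₀ L),
            IsDihedralExtension K₀ L ∧ Module.finrank K₀ L = 2 * ℓ ^ n) ↔
          Module.finrank K₀ K₀⟮ρ⟯ = 2 ∧ n ≤ d) ∧
        (Module.finrank K₀ K₀⟮ρ⟯ = 2 ∧ n ≤ d →
          ∀ α : Ω, α ^ (ℓ ^ n) = algebraMap K₀ Ω (π : K₀) →
            IsDihedralExtension K₀ K₀⟮ρ, α⟯ ∧
            Module.finrank K₀ K₀⟮ρ, α⟯ = 2 * ℓ ^ n ∧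
            ∀ (L : Type w) [Field L] [Algebra K₀ L],
              IsDihedralExtension K₀ L → Module.finrank K₀ L = 2 * ℓ ^ n →
                Nonempty (L ≃ₐ[K₀] K₀⟮ρ, α⟯)) := by
  have hdvr : IsDiscreteValuationRing 𝒪[K₀] := inferInstance
  let := IsTopologicalAddGroup.rightUniformSpace K₀
  have := isUniformAddGroup_of_addCommGroup (G := K₀)
  -- An order embedding of the value group into the nonnegative reals gives a norm that compares
  -- elements exactly as the valuation does.
  let hrank : (Valued.v (R := K₀)).RankOne :=
    { hom' := ValuativeRel.IsRankLeOne.nonempty.some.emb (R := K₀).comp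
        MonoidWithZeroHom.ValueGroup₀.embedding
      strictMono' := ValuativeRel.IsRankLeOne.nonempty.some.strictMono.comp
        MonoidWithZeroHom.ValueGroup₀.embedding_strictMono }
  let : NontriviallyNormedField K₀ := Valued.toNontriviallyNormedField K₀ _
  have hlt : ∀ x y : K₀, ‖x‖ < ‖y‖ ↔ ValuativeRel.valuation K₀ x < ValuativeRel.valuation K₀ y := fun x y =>
    Valued.toNormedField.norm_lt_iff
  have hle : ∀ x y : K₀, ‖x‖ ≤ ‖y‖ ↔ ValuativeRel.valuation K₀ x ≤ ValuativeRel.valuation K₀ y := fun x y =>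
    Valued.toNormedField.norm_le_iff
  have hult : IsUltrametricDist K₀ := by
    refine IsUltrametricDist.isUltrametricDist_of_forall_norm_add_le_max_norm fun x y => ?_
    rcases le_total ‖x‖ ‖y‖ with h | h
    · rw [max_eq_right h, hle]
      exact (Valuation.map_add _ x y).trans (max_le ((hle _ _).1 h) le_rfl)
    · rw [max_eq_left h, hle]
      exact (Valuation.map_add _ x y).trans (max_le le_rfl ((hle _ _).1 h))
  have hprop : ProperSpace K₀ := .of_nontriviallyNormedField_of_weaklyLocallyCompactSpace K₀
  have heq : ∀ x y : K₀, ‖x‖ = ‖y‖ ↔ ValuativeRel.valuation K₀ x = ValuativeRel.valuation K₀ y := fun x y => by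
    rw [le_antisymm_iff, le_antisymm_iff, hle, hle]
  refine dihedral_classification_of_normed (π := (π : K₀)) ?_ ?_ ?_ hℓ hℓodd ?_ ρ hρ
  · exact fun h => hπ.ne_zero (Subtype.ext h)
  · rw [← norm_one (α := K₀), hlt, map_one]
    exact Valuation.integer.v_irreducible_lt_one hπ
  · intro x hx
    obtain ⟨j, hj⟩ := exists_valuation_eq_zpow_of_irreducible hπ hx
    refine ⟨j, ?_⟩
    rw [← norm_zpow, heq, hj, map_zpow₀]
  · rw [← norm_one (α := K₀), heq, map_one]
    exact valuation_natCast_eq_one_of_ne_ringChar hℓ hℓchar
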